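/- For real-valued $V\in L^1(\mathbb{R})$ let $H_V=-\frac{d^2}{dx^2}+V$ be the self-adjoint operator on $L^2(\mathbb{R})$ associated with the quadratic form $u\mapsto\int_{\mathbb{R}}|u'|^2\,dx+\int_{\mathbb{R}}V|u|^2\,dx$ with form domain $H^1(\mathbb{R})$. Let $(\mu_j)_j$ be the (finite or infinite) family of negative eigenvalues of $H_V$, counted with multiplicity, and let $V_-=(|V|-V)/2$. Then, for every real-valued $V\in L^1(\mathbb{R})$, $$\sum_j|\mu_j|^{1/2}\le\frac12\int_{\mathbb{R}}V(x)_-\,dx .$$ The constant $\frac12$ is the best possible: if $C\in\mathbb{R}$ is such that $\sum_j|\mu_j|^{1/2}\le C\int_{\mathbb{R}}V(x)_-\,dx$ for all real-valued $V\in L^1(\mathbb{R})$, then $C\ge\frac12$. Moreover $\frac12=2L^{\mathrm{cl}}_{1/2,1}$, where $L^{\mathrm{cl}}_{\gamma,d}=(4\pi)^{-d/2}\,\Gamma(\gamma+1)/\Gamma(\gamma+1+\tfrac d2)$. -/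

import Mathlib

open MeasureTheory
open scoped ContDiff

/-- The complex Hilbert space `L²(ℝ)` (Lebesgue measure). -/
abbrev L2R : Type := Lp ℂ 2 (volume : Measure ℝ)

/-- `v` is the weak derivative of `u`, both in `L²(ℝ)`; so `u ∈ H¹(ℝ)` iff such a `v` exists. -/
def HasWeakDeriv (u v : L2R) : Prop :=
  ∀ φ : ℝ → ℝ, ContDiff ℝ ∞ φ → HasCompactSupport φ →
    ∫ x, deriv φ x • u x = -∫ x, φ x • v x

/-- The function `V φ̄ u`, whose integral is the potential part of the quadratic form. -/
noncomputable def potentialDensity (V : ℝ → ℝ) (φ u : L2R) : ℝ → ℂ :=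
  fun x => (V x : ℂ) * (starRingEnd ℂ (φ x) * u x)

/-- `u` lies in the domain of the operator of the form
`h(φ, u) = ∫ φ̄' u' + ∫ V φ̄ u` with form domain `H¹(ℝ)`, and the operator maps `u` to `w`:
`u ∈ H¹(ℝ)` and `h(φ, u) = ⟨φ, w⟩` for all `φ ∈ H¹(ℝ)`. -/
def IsSchrodingerPair (V : ℝ → ℝ) (u w : L2R) : Prop :=
  ∃ u' : L2R, HasWeakDeriv u u' ∧
    ∀ φ φ' : L2R, HasWeakDeriv φ φ' →
      Integrable (potentialDensity V φ u) ∧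
        inner ℂ φ' u' + ∫ x, potentialDensity V φ u x = inner ℂ φ w

theorem L2R.integrable_smul (u : L2R) {φ : ℝ → ℝ} (hφ : Continuous φ)
    (hc : HasCompactSupport φ) : Integrable (fun x => φ x • u x) := by
  have h1 : MemLp φ 2 (volume : Measure ℝ) := hφ.memLp_of_hasCompactSupport hc
  exact memLp_one_iff_integrable.1 ((Lp.memLp u).smul h1)

theorem HasWeakDeriv.add {u₁ v₁ u₂ v₂ : L2R} (h₁ : HasWeakDeriv u₁ v₁)
    (h₂ : HasWeakDeriv u₂ v₂) : HasWeakDeriv (u₁ + u₂) (v₁ + v₂) := by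
  intro φ hφ hc
  have hd : Continuous (deriv φ) := hφ.continuous_deriv (by simp)
  have e1 : ∫ x, deriv φ x • (u₁ + u₂ : L2R) x
      = ∫ x, (deriv φ x • u₁ x + deriv φ x • u₂ x) := by
    apply integral_congr_ae
    filter_upwards [Lp.coeFn_add u₁ u₂] with x hx
    rw [hx, Pi.add_apply, smul_add]
  have e2 : ∫ x, φ x • (v₁ + v₂ : L2R) x = ∫ x, (φ x • v₁ x + φ x • v₂ x) := by
    apply integral_congr_ae
    filter_upwards [Lp.coeFn_add v₁ v₂] with x hx
    rw [hx, Pi.add_apply, smul_add]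
  rw [e1, e2, integral_add (u₁.integrable_smul hd hc.deriv) (u₂.integrable_smul hd hc.deriv),
    integral_add (v₁.integrable_smul hφ.continuous hc) (v₂.integrable_smul hφ.continuous hc),
    h₁ φ hφ hc, h₂ φ hφ hc]
  ring

theorem HasWeakDeriv.smul {u v : L2R} (c : ℂ) (h : HasWeakDeriv u v) :
    HasWeakDeriv (c • u) (c • v) := by
  intro φ hφ hc
  have e1 : ∫ x, deriv φ x • (c • u : L2R) x = ∫ x, c • (deriv φ x • u x) := by
    apply integral_congr_ae
    filter_upwards [Lp.coeFn_smul c u] with x hx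
    simp only [hx, Pi.smul_apply]
    rw [smul_comm]
  have e2 : ∫ x, φ x • (c • v : L2R) x = ∫ x, c • (φ x • v x) := by
    apply integral_congr_ae
    filter_upwards [Lp.coeFn_smul c v] with x hx
    simp only [hx, Pi.smul_apply]
    rw [smul_comm]
  rw [e1, e2, integral_smul, integral_smul, h φ hφ hc, smul_neg]

theorem HasWeakDeriv.zero : HasWeakDeriv 0 0 := by
  intro φ _ _
  have e (f : ℝ → ℝ) : ∫ x, f x • (0 : L2R) x = 0 := by
    apply integral_eq_zero_of_ae
    filter_upwards [Lp.coeFn_zero ℂ 2 (volume : Measure ℝ)] with x _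
    simp
  rw [e, e, neg_zero]

theorem HasWeakDeriv.eq_zero {v : L2R} (h : HasWeakDeriv 0 v) : v = 0 := by
  have hv : LocallyIntegrable (v : ℝ → ℂ) volume :=
    (Lp.memLp v).locallyIntegrable (by norm_num)
  have : ∀ᵐ x ∂(volume : Measure ℝ), v x = 0 := by
    apply ae_eq_zero_of_integral_contDiff_smul_eq_zero hv
    intro φ hφ hc
    have h0 : ∫ x, deriv φ x • (0 : L2R) x = 0 := by
      apply integral_eq_zero_of_ae
      filter_upwards [Lp.coeFn_zero ℂ 2 (volume : Measure ℝ)] with x _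
      simp
    have := h φ hφ hc
    rw [h0] at this
    simpa using this.symm
  exact (Lp.eq_zero_iff_ae_eq_zero).2 this

/-- A smooth compactly supported function, as an element of `L²(ℝ)`, has its classical derivative
as weak derivative. -/
theorem hasWeakDeriv_of_contDiff {φ : ℝ → ℝ} (hφ : ContDiff ℝ ∞ φ) (hc : HasCompactSupport φ) :
    ∃ f f' : L2R, HasWeakDeriv f f' ∧ ∀ᵐ x, f x = (φ x : ℂ) := by
  have hd : Continuous (deriv φ) := hφ.continuous_deriv (by simp)
  have m1 : MemLp (fun x => (φ x : ℂ)) 2 (volume : Measure ℝ) :=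
    (hφ.continuous.memLp_of_hasCompactSupport hc).ofReal
  have m2 : MemLp (fun x => ((deriv φ x : ℝ) : ℂ)) 2 (volume : Measure ℝ) :=
    (hd.memLp_of_hasCompactSupport hc.deriv).ofReal
  refine ⟨m1.toLp _, m2.toLp _, ?_, m1.coeFn_toLp⟩
  intro ψ hψ hcψ
  have e1 : ∫ x, deriv ψ x • (m1.toLp _ : L2R) x = ∫ x, ((deriv ψ x * φ x : ℝ) : ℂ) := by
    apply integral_congr_ae
    filter_upwards [m1.coeFn_toLp] with x hx
    simp [hx]
  have e2 : ∫ x, ψ x • (m2.toLp _ : L2R) x = ∫ x, ((ψ x * deriv φ x : ℝ) : ℂ) := by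
    apply integral_congr_ae
    filter_upwards [m2.coeFn_toLp] with x hx
    simp [hx]
  have hdψ : Continuous (deriv ψ) := hψ.continuous_deriv (by simp)
  have key : ∫ x, ψ x * deriv φ x = -∫ x, deriv ψ x * φ x := by
    apply integral_mul_deriv_eq_deriv_mul_of_integrable
    · exact fun x _ => (hψ.differentiable (by simp) x).hasDerivAt
    · exact fun x _ => (hφ.differentiable (by simp) x).hasDerivAt
    · exact (hψ.continuous.mul hd).integrable_of_hasCompactSupport hcψ.mul_right
    · exact (hdψ.mul hφ.continuous).integrable_of_hasCompactSupport hcψ.deriv.mul_right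
    · exact (hψ.continuous.mul hφ.continuous).integrable_of_hasCompactSupport hcψ.mul_right
  rw [e1, e2, integral_complex_ofReal, integral_complex_ofReal, key]
  simp

theorem potentialDensity_add (V : ℝ → ℝ) (φ u₁ u₂ : L2R) :
    potentialDensity V φ (u₁ + u₂) =ᵐ[volume]
      fun x => potentialDensity V φ u₁ x + potentialDensity V φ u₂ x := by
  filter_upwards [Lp.coeFn_add u₁ u₂] with x hx
  simp only [potentialDensity, hx, Pi.add_apply]
  ring

theorem potentialDensity_smul (V : ℝ → ℝ) (φ u : L2R) (c : ℂ) :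
    potentialDensity V φ (c • u) =ᵐ[volume] fun x => c * potentialDensity V φ u x := by
  filter_upwards [Lp.coeFn_smul c u] with x hx
  simp only [potentialDensity, hx, Pi.smul_apply, smul_eq_mul]
  ring

theorem potentialDensity_zero (V : ℝ → ℝ) (φ : L2R) :
    potentialDensity V φ 0 =ᵐ[volume] fun _ => 0 := by
  filter_upwards [Lp.coeFn_zero ℂ 2 (volume : Measure ℝ)] with x _
  simp [potentialDensity]

/-- The graph of the Schrödinger operator `-d²/dx² + V`. -/
noncomputable def schrodingerGraph (V : ℝ → ℝ) : Submodule ℂ (L2R × L2R) where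
  carrier := {p | IsSchrodingerPair V p.1 p.2}
  zero_mem' := by
    refine ⟨0, HasWeakDeriv.zero, fun φ φ' _ => ⟨?_, ?_⟩⟩
    · exact (integrable_congr (potentialDensity_zero V φ)).2 (integrable_zero _ _ _)
    · rw [Prod.fst_zero, Prod.snd_zero, integral_congr_ae (potentialDensity_zero V φ)]
      simp
  add_mem' := by
    rintro ⟨u₁, w₁⟩ ⟨u₂, w₂⟩ ⟨v₁, hv₁, h₁⟩ ⟨v₂, hv₂, h₂⟩
    refine ⟨v₁ + v₂, hv₁.add hv₂, fun φ φ' hφ => ?_⟩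
    obtain ⟨i₁, e₁⟩ := h₁ φ φ' hφ
    obtain ⟨i₂, e₂⟩ := h₂ φ φ' hφ
    refine ⟨(integrable_congr (potentialDensity_add V φ u₁ u₂)).2 (i₁.add i₂), ?_⟩
    simp only [Prod.mk_add_mk]
    rw [integral_congr_ae (potentialDensity_add V φ u₁ u₂), integral_add i₁ i₂,
      inner_add_right, inner_add_right, ← e₁, ← e₂]
    ring
  smul_mem' := by
    rintro c ⟨u, w⟩ ⟨v, hv, h⟩
    refine ⟨c • v, hv.smul c, fun φ φ' hφ => ?_⟩
    obtain ⟨i, e⟩ := h φ φ' hφ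
    refine ⟨(integrable_congr (potentialDensity_smul V φ u c)).2 (i.const_mul c), ?_⟩
    simp only [Prod.smul_mk]
    rw [integral_congr_ae (potentialDensity_smul V φ u c), integral_const_mul,
      inner_smul_right, inner_smul_right, ← e]
    ring

theorem schrodingerGraph_functional (V : ℝ → ℝ) (p : L2R × L2R) (hp : p ∈ schrodingerGraph V)
    (h0 : p.1 = 0) : p.2 = 0 := by
  obtain ⟨u, w⟩ := p
  obtain ⟨v, hv, h⟩ := hp
  simp only at h0 hv h
  subst h0
  have hv0 := hv.eq_zero
  subst hv0
  have hw : LocallyIntegrable (w : ℝ → ℂ) volume :=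
    (Lp.memLp w).locallyIntegrable (by norm_num)
  have : ∀ᵐ x ∂(volume : Measure ℝ), w x = 0 := by
    apply ae_eq_zero_of_integral_contDiff_smul_eq_zero hw
    intro φ hφ hc
    obtain ⟨f, f', hf, hfφ⟩ := hasWeakDeriv_of_contDiff hφ hc
    have e := (h f f' hf).2
    rw [integral_congr_ae (potentialDensity_zero V f), inner_zero_right, integral_zero,
      add_zero, L2.inner_def] at e
    rw [e]
    apply integral_congr_ae
    filter_upwards [hfφ] with x hx
    simp [hx, mul_comm]
  exact (Lp.eq_zero_iff_ae_eq_zero).2 this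

/-- The Schrödinger operator `-d²/dx² + V` on `L²(ℝ)`, as an unbounded operator. -/
noncomputable def schrodingerOp (V : ℝ → ℝ) : L2R →ₗ.[ℂ] L2R :=
  (schrodingerGraph V).toLinearPMap

theorem schrodingerOp_graph (V : ℝ → ℝ) : (schrodingerOp V).graph = schrodingerGraph V :=
  Submodule.toLinearPMap_graph_eq _ (schrodingerGraph_functional V)

/-- The eigenspace `{u ∈ dom H : H u = μ u}` of an unbounded operator. -/
noncomputable def opEigenspace (H : L2R →ₗ.[ℂ] L2R) (μ : ℝ) : Submodule ℂ L2R :=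
  H.graph.comap (LinearMap.prod LinearMap.id ((μ : ℂ) • LinearMap.id))

/-- The multiplicity of `μ` as an eigenvalue of `H`: `0` if `μ` is not an eigenvalue, and `⊤` if
the eigenspace has infinite dimension. -/
noncomputable def eigenMultiplicity (H : L2R →ₗ.[ℂ] L2R) (μ : ℝ) : ℕ∞ :=
  Cardinal.toENat (Module.rank ℂ (opEigenspace H μ))

/-- `∑ⱼ |μⱼ|^γ` over the negative eigenvalues of `H`, counted with multiplicity. -/
noncomputable def negEigenvalueSum (H : L2R →ₗ.[ℂ] L2R) (γ : ℝ) : ENNReal :=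
  ∑' μ : Set.Iio (0 : ℝ),
    ((eigenMultiplicity H μ : ℕ∞) : ENNReal) * ENNReal.ofReal (|(μ : ℝ)| ^ γ)

/-- The semi-classical Lieb–Thirring constant `(4π)^(-d/2) Γ(γ+1) / Γ(γ+1+d/2)`. -/
noncomputable def semiclassicalConst (γ : ℝ) (d : ℕ) : ℝ :=
  (4 * Real.pi) ^ (-(d : ℝ) / 2) * Real.Gamma (γ + 1) / Real.Gamma (γ + 1 + (d : ℝ) / 2)

/-! Upper bound. Put L(κ) = √V₋ · e^{-κ|x-y|} · √V₋, which is 2κ times the Birman–Schwinger operator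
at energy -κ². If -κ₀² ≤ … ≤ -κₖ² are negative eigenvalues counted with multiplicity, the
Birman–Schwinger principle gives L(κₖ) at least k+1 eigenvalues that are at least 2κₖ. The factor 2κ
is chosen so that the trace of L(κ) is ∫V₋ for every κ.

The decisive point is monotonicity. For κ' ≤ κ the kernel of L(κ) is the pointwise product of that
of L(κ') with e^{-(κ-κ')|x-y|}, a positive kernel equal to 1 on the diagonal, and such Schur
multipliers cannot increase the sum of the k largest eigenvalues (`KyFanBound.of_hadamard`). So if
the k largest eigenvalues of L(κₖ) sum to at least 2(κ₀+…+κₖ₋₁), the k+1 largest sum to at least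
2(κ₀+…+κₖ) (`KyFanBound.succ`), and this persists for all smaller κ. The induction ends with 2∑κⱼ ≤
tr L = ∫V₋ (`two_mul_sum_le_sum_weights`).

This is carried out for matrices: V₋ is replaced by finitely many point masses of the same total
mass, at the cost of ε times the squared H¹ norm (`exists_point_interactions`), and ε tends to 0.
Positivity of the kernel and the Birman–Schwinger principle both come from `two_mul_re_sum_le`, a
completed square built on the reproducing property of the Green function.

Sharpness. The potential -ν(ν+1)/cosh² has the eigenvalue -ν² with eigenfunction cosh^{-ν}, while
∫V₋ = 2ν(ν+1). The ratio ν / (2ν(ν+1)) tends to 1/2 as ν → 0. -/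

open Filter Topology

/-! ### Calculus of locally absolutely continuous functions. -/

/-- `F` is a primitive of the locally integrable function `f` (so `F` is locally absolutely
continuous with almost everywhere derivative `f`). -/
structure IsPrimitive {E : Type*} [NormedAddCommGroup E] [NormedSpace ℝ E] (F f : ℝ → E) :
    Prop where
  intervalIntegrable : ∀ a b : ℝ, IntervalIntegrable f volume a b
  sub_eq : ∀ a b : ℝ, F b - F a = ∫ x in a..b, f x

theorem MeasureTheory.LocallyIntegrable.intervalIntegrable_real {E : Type*} [NormedAddCommGroup E]
    {f : ℝ → E} (hf : LocallyIntegrable f volume) (a b : ℝ) : IntervalIntegrable f volume a b := by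
  rw [intervalIntegrable_iff]
  exact (hf.integrableOn_isCompact isCompact_uIcc).mono_set Set.uIoc_subset_uIcc

namespace IsPrimitive

section general

variable {E E' : Type*} [NormedAddCommGroup E] [NormedSpace ℝ E] [NormedAddCommGroup E']
  [NormedSpace ℝ E'] {F f G g : ℝ → E}

theorem eq_add (h : IsPrimitive F f) (a : ℝ) : F = fun x => F a + ∫ t in a..x, f t := by
  funext x
  rw [← h.sub_eq a x]
  abel

theorem continuous (h : IsPrimitive F f) : Continuous F := by
  rw [h.eq_add 0]
  exact continuous_const.add (intervalIntegral.continuous_primitive h.intervalIntegrable 0)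

theorem of_integral (h : ∀ a b : ℝ, IntervalIntegrable f volume a b) (c : E) :
    IsPrimitive (fun x => c + ∫ t in (0 : ℝ)..x, f t) f := by
  refine ⟨h, fun a b => ?_⟩
  rw [add_sub_add_left_eq_sub, intervalIntegral.integral_interval_sub_left (h _ _) (h _ _)]

theorem add (h : IsPrimitive F f) (h' : IsPrimitive G g) :
    IsPrimitive (fun x => F x + G x) (fun x => f x + g x) := by
  refine ⟨fun a b => (h.intervalIntegrable a b).add (h'.intervalIntegrable a b), fun a b => ?_⟩
  rw [intervalIntegral.integral_add (h.intervalIntegrable a b) (h'.intervalIntegrable a b),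
    ← h.sub_eq, ← h'.sub_eq]
  abel

theorem clm_comp [CompleteSpace E] [CompleteSpace E'] (h : IsPrimitive F f) (L : E →L[ℝ] E') :
    IsPrimitive (fun x => L (F x)) (fun x => L (f x)) := by
  refine ⟨fun a b => ?_, fun a b => ?_⟩
  · exact ⟨L.integrable_comp (h.intervalIntegrable a b).1,
      L.integrable_comp (h.intervalIntegrable a b).2⟩
  · rw [L.intervalIntegral_comp_comm (h.intervalIntegrable a b), ← h.sub_eq, map_sub]

theorem congr_ae (h : IsPrimitive F f) (hfg : f =ᵐ[volume] g) : IsPrimitive F g := by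
  refine ⟨fun a b => (h.intervalIntegrable a b).congr_ae (ae_restrict_of_ae hfg), fun a b => ?_⟩
  rw [h.sub_eq]
  exact intervalIntegral.integral_congr_ae (hfg.mono fun x hx _ => hx)

theorem of_hasDerivAt_off_countable [CompleteSpace E] {s : Set ℝ} (hs : s.Countable)
    (hF : Continuous F) (hd : ∀ x ∉ s, HasDerivAt F (f x) x)
    (hf : ∀ a b : ℝ, IntervalIntegrable f volume a b) : IsPrimitive F f :=
  ⟨hf, fun a b => (integral_eq_of_hasDerivAt_off_countable F f hs hF.continuousOn
    (fun x hx => hd x hx.2) (hf a b)).symm⟩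

theorem of_hasDerivAt [CompleteSpace E] (hd : ∀ x, HasDerivAt F (f x) x) (hf : Continuous f) :
    IsPrimitive F f :=
  of_hasDerivAt_off_countable Set.countable_empty
    (continuous_iff_continuousAt.2 fun x => (hd x).continuousAt) (fun x _ => hd x)
    fun a b => hf.intervalIntegrable a b

/-- Integrability of `f` gives `F` a limit at infinity, and integrability of `F` forces that limit
to be 0. This is how boundary terms vanish below. -/
theorem add_integral_Ioi_eq_zero (h : IsPrimitive F f) {a : ℝ} (hf : IntegrableOn f (Set.Ioi a))
    (hF : IntegrableOn F (Set.Ioi a)) : F a + ∫ x in Set.Ioi a, f x = 0 := by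
  have ht : Tendsto F atTop (𝓝 (F a + ∫ x in Set.Ioi a, f x)) := by
    have := (intervalIntegral_tendsto_integral_Ioi a hf tendsto_id).const_add (F a)
    refine this.congr fun b => ?_
    rw [id, ← h.sub_eq]
    abel
  refine IntegrableAtFilter.eq_zero_of_tendsto (μ := volume)
    ⟨Set.Ioi a, Ioi_mem_atTop a, hF⟩ (fun s hs => ?_) ht
  obtain ⟨b, hb⟩ := mem_atTop_sets.1 hs
  rw [← top_le_iff, ← Real.volume_Ici (a := b)]
  exact measure_mono hb

theorem integral_Ioi (h : IsPrimitive F f) {a : ℝ} (hf : IntegrableOn f (Set.Ioi a))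
    (hF : IntegrableOn F (Set.Ioi a)) : ∫ x in Set.Ioi a, f x = -F a :=
  eq_neg_of_add_eq_zero_right (h.add_integral_Ioi_eq_zero hf hF)

theorem integral_Iic (h : IsPrimitive F f) {a : ℝ} (hf : IntegrableOn f (Set.Iic a))
    (hF : IntegrableOn F (Set.Iic a)) : ∫ x in Set.Iic a, f x = F a := by
  have ht : Tendsto F atBot (𝓝 (F a - ∫ x in Set.Iic a, f x)) := by
    have := (intervalIntegral_tendsto_integral_Iic a hf tendsto_id).const_sub (F a)
    refine this.congr fun b => ?_
    rw [id, ← h.sub_eq]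
    abel
  have h0 := IntegrableAtFilter.eq_zero_of_tendsto (μ := volume)
    ⟨Set.Iic a, Iic_mem_atBot a, hF⟩ (fun s hs => ?_) ht
  · exact (sub_eq_zero.1 h0).symm
  obtain ⟨b, hb⟩ := mem_atBot_sets.1 hs
  rw [← top_le_iff, ← Real.volume_Iic (a := b)]
  exact measure_mono hb

theorem integral_eq_zero (h : IsPrimitive F f) (hf : Integrable f) (hF : Integrable F) :
    ∫ x, f x = 0 := by
  rw [← intervalIntegral.integral_Iic_add_Ioi (b := 0) hf.integrableOn hf.integrableOn,
    h.integral_Iic hf.integrableOn hF.integrableOn, h.integral_Ioi hf.integrableOn hF.integrableOn,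
    add_neg_cancel]

end general

theorem absolutelyContinuousOnInterval {F f : ℝ → ℝ} (h : IsPrimitive F f) (a b : ℝ) :
    AbsolutelyContinuousOnInterval F a b := by
  rw [h.eq_add a]
  have h1 : AbsolutelyContinuousOnInterval (fun _ : ℝ => F a) a b :=
    (contDiff_const (n := 1)).contDiffOn.absolutelyContinuousOnInterval
  exact h1.add ((h.intervalIntegrable a b).absolutelyContinuousOnInterval_intervalIntegral
    Set.left_mem_uIcc)

theorem ae_hasDerivAt {F f : ℝ → ℝ} (h : IsPrimitive F f) (a b : ℝ) :
    ∀ᵐ x, x ∈ Set.uIcc a b → HasDerivAt F (f x) x := by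
  filter_upwards [(h.intervalIntegrable a b).ae_hasDerivAt_integral] with x hx hxm
  rw [h.eq_add a]
  exact (hx hxm a Set.left_mem_uIcc).const_add _

/-- Integration by parts for absolutely continuous functions; combined with vanishing at infinity it
yields every integration by parts against elements of H¹. -/
theorem mul_real {F f G g : ℝ → ℝ} (h : IsPrimitive F f) (h' : IsPrimitive G g) :
    IsPrimitive (fun x => F x * G x) (fun x => f x * G x + F x * g x) := by
  refine ⟨fun a b => ?_, fun a b => ?_⟩
  · exact ((h.intervalIntegrable a b).mul_continuousOn h'.continuous.continuousOn).add
      ((h'.intervalIntegrable a b).continuousOn_mul h.continuous.continuousOn)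
  · rw [← (h.absolutelyContinuousOnInterval a b).integral_deriv_mul_eq_sub
      (h'.absolutelyContinuousOnInterval a b)]
    apply intervalIntegral.integral_congr_ae
    filter_upwards [h.ae_hasDerivAt a b, h'.ae_hasDerivAt a b] with x hx hx' hm
    rw [(hx (Set.uIoc_subset_uIcc hm)).deriv, (hx' (Set.uIoc_subset_uIcc hm)).deriv]

theorem of_re_im {F f : ℝ → ℂ} (h : IsPrimitive (fun x => (F x).re) (fun x => (f x).re))
    (h' : IsPrimitive (fun x => (F x).im) (fun x => (f x).im)) : IsPrimitive F f := by
  have e := (h.clm_comp Complex.ofRealCLM).add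
    (h'.clm_comp ((ContinuousLinearMap.mul ℝ ℂ Complex.I).comp Complex.ofRealCLM))
  convert e using 1
  · funext x
    simp [mul_comm Complex.I, Complex.re_add_im]
  · funext x
    simp [mul_comm Complex.I, Complex.re_add_im]

theorem mul {F f G g : ℝ → ℂ} (h : IsPrimitive F f) (h' : IsPrimitive G g) :
    IsPrimitive (fun x => F x * G x) (fun x => f x * G x + F x * g x) := by
  have r1 := h.clm_comp Complex.reCLM
  have i1 := h.clm_comp Complex.imCLM
  have r2 := h'.clm_comp Complex.reCLM
  have i2 := h'.clm_comp Complex.imCLM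
  apply of_re_im
  · convert (r1.mul_real r2).add ((i1.mul_real i2).clm_comp (-ContinuousLinearMap.id ℝ ℝ)) using 1
    · funext x
      simp
      ring
    · funext x
      simp
      ring
  · convert (r1.mul_real i2).add (i1.mul_real r2) using 1
    · funext x
      simp
    · funext x
      simp
      ring

theorem conj {F f : ℝ → ℂ} (h : IsPrimitive F f) :
    IsPrimitive (fun x => starRingEnd ℂ (F x)) (fun x => starRingEnd ℂ (f x)) :=
  h.clm_comp (Complex.conjCLE : ℂ →L[ℝ] ℂ)

theorem const_mul {F f : ℝ → ℂ} (h : IsPrimitive F f) (c : ℂ) :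
    IsPrimitive (fun x => c * F x) (fun x => c * f x) :=
  h.clm_comp (ContinuousLinearMap.mul ℝ ℂ c)

theorem ofReal {F f : ℝ → ℝ} (h : IsPrimitive F f) :
    IsPrimitive (fun x => (F x : ℂ)) (fun x => (f x : ℂ)) :=
  h.clm_comp Complex.ofRealCLM

theorem sum {ι : Type*} (s : Finset ι) {F f : ι → ℝ → ℂ} (h : ∀ i ∈ s, IsPrimitive (F i) (f i)) :
    IsPrimitive (fun x => ∑ i ∈ s, F i x) (fun x => ∑ i ∈ s, f i x) := by
  classical
  induction s using Finset.induction_on with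
  | empty => exact ⟨fun a b => by simp, fun a b => by simp⟩
  | insert i s hi ih =>
    simp only [Finset.sum_insert hi]
    exact (h i (by simp)).add (ih fun j hj => h j (by simp [hj]))

end IsPrimitive

/-! ### Weak derivatives and continuous representatives. -/

theorem L2R.locallyIntegrable (u : L2R) : LocallyIntegrable (u : ℝ → ℂ) volume :=
  (Lp.memLp u).locallyIntegrable (by norm_num)

theorem IsPrimitive.integral_deriv_smul {F f : ℝ → ℂ} (h : IsPrimitive F f)
    {φ : ℝ → ℝ} (hφ : ContDiff ℝ ∞ φ) (hc : HasCompactSupport φ)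
    (hf : LocallyIntegrable f volume) :
    ∫ x, deriv φ x • F x = -∫ x, φ x • f x := by
  have hd : Continuous (deriv φ) := hφ.continuous_deriv (by simp)
  have hp : IsPrimitive φ (deriv φ) :=
    .of_hasDerivAt (fun x => (hφ.differentiable (by simp) x).hasDerivAt) hd
  have hprod := hp.ofReal.mul h
  have hF : LocallyIntegrable F volume := h.continuous.locallyIntegrable
  have i1 : Integrable (fun x => deriv φ x • F x) :=
    hF.integrable_smul_left_of_hasCompactSupport hd hc.deriv
  have i2 : Integrable (fun x => φ x • f x) :=
    hf.integrable_smul_left_of_hasCompactSupport hφ.continuous hc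
  have i3 : Integrable (fun x => φ x • F x) :=
    hF.integrable_smul_left_of_hasCompactSupport hφ.continuous hc
  simp only [Complex.real_smul] at *
  have := hprod.integral_eq_zero (i1.add i2) i3
  rw [integral_add i1 i2] at this
  exact eq_neg_of_add_eq_zero_left this

/-- Smooth compactly supported functions of vanishing integral are derivatives of smooth compactly
supported functions. -/
theorem exists_contDiff_deriv_eq {φ : ℝ → ℝ} (hφ : ContDiff ℝ ∞ φ) (hc : HasCompactSupport φ)
    (h0 : ∫ x, φ x = 0) :
    ∃ χ : ℝ → ℝ, ContDiff ℝ ∞ χ ∧ HasCompactSupport χ ∧ deriv χ = φ := by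
  obtain ⟨R, hR⟩ := hc.isCompact.isBounded.subset_closedBall 0
  rw [Real.closedBall_eq_Icc, zero_sub, zero_add] at hR
  have hsupp : ∀ x, φ x ≠ 0 → x ∈ Set.Icc (-R) R := fun x hx =>
    hR (subset_tsupport φ (Function.mem_support.2 hx))
  -- The base point lies strictly left of `-R`: interval integrals run over half-open intervals, and
  -- the whole support has to lie in `Ioc (-R - 1) x` for `x > R`.
  have hd : ∀ x, HasDerivAt (fun y => ∫ t in (-R - 1)..y, φ t) (φ x) x := fun x =>
    intervalIntegral.integral_hasDerivAt_right (hφ.continuous.intervalIntegrable _ _)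
      (hφ.continuous.stronglyMeasurableAtFilter _ _) hφ.continuous.continuousAt
  have hdd : deriv (fun y => ∫ t in (-R - 1)..y, φ t) = φ := funext fun x => (hd x).deriv
  refine ⟨fun y => ∫ t in (-R - 1)..y, φ t, ?_, ?_, hdd⟩
  · rw [contDiff_infty_iff_deriv, hdd]
    exact ⟨fun x => (hd x).differentiableAt, hφ⟩
  · refine HasCompactSupport.intro (K := Set.Icc (-R - 1) R) isCompact_Icc fun x hx => ?_
    rcases lt_or_ge x (-R - 1) with h | h
    · refine intervalIntegral.integral_zero_ae (ae_of_all _ fun t ht => ?_)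
      by_contra hne
      have h1 := (hsupp t hne).1
      rw [Set.uIoc_of_ge h.le] at ht
      linarith [ht.2]
    · have h' : R < x := by
        by_contra hle
        exact hx ⟨h, not_lt.1 hle⟩
      rw [intervalIntegral.integral_eq_integral_of_support_subset, h0]
      intro t ht
      have := hsupp t ht
      exact ⟨by linarith [this.1], by linarith [this.2]⟩

/-- The du Bois-Reymond lemma: a locally integrable function with vanishing weak derivative is
almost everywhere constant. -/
theorem ae_eq_const_of_integral_deriv_smul_eq_zero {f : ℝ → ℂ} (hf : LocallyIntegrable f volume)
    (h : ∀ φ : ℝ → ℝ, ContDiff ℝ ∞ φ → HasCompactSupport φ → ∫ x, deriv φ x • f x = 0) :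
    ∃ c : ℂ, ∀ᵐ x, f x = c := by
  let b : ContDiffBump (0 : ℝ) := ⟨1, 2, one_pos, one_lt_two⟩
  let ψ : ℝ → ℝ := b.normed volume
  have hψ : ContDiff ℝ ∞ ψ := b.contDiff_normed
  have hψc : HasCompactSupport ψ := b.hasCompactSupport_normed
  have hψ1 : ∫ x, ψ x = 1 := b.integral_normed
  refine ⟨∫ x, ψ x • f x, ?_⟩
  have hcl : LocallyIntegrable (fun _ : ℝ => ∫ x, ψ x • f x) volume :=
    continuous_const.locallyIntegrable
  have key : ∀ᵐ x, f x - (∫ x, ψ x • f x) = 0 := by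
    refine ae_eq_zero_of_integral_contDiff_smul_eq_zero (hf.sub hcl) fun φ hφ hφc => ?_
    have iφ : Integrable φ := hφ.continuous.integrable_of_hasCompactSupport hφc
    have iψ : Integrable ψ := hψ.continuous.integrable_of_hasCompactSupport hψc
    -- Subtracting the right multiple of the bump `ψ` makes the integral vanish, so the test
    -- function becomes a derivative, against which `f` integrates to 0.
    obtain ⟨χ, hχ, hχc, hχd⟩ := exists_contDiff_deriv_eq
      (φ := fun x => φ x - (∫ y, φ y) * ψ x) (hφ.sub (contDiff_const.mul hψ))
      (hφc.sub hψc.mul_left) (by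
        rw [integral_sub iφ (iψ.const_mul _), integral_const_mul, hψ1, mul_one, sub_self])
    have h1 := h χ hχ hχc
    have i1 : Integrable (fun x => φ x • f x) :=
      hf.integrable_smul_left_of_hasCompactSupport hφ.continuous hφc
    have i2 : Integrable (fun x => ψ x • f x) :=
      hf.integrable_smul_left_of_hasCompactSupport hψ.continuous hψc
    have i3 : Integrable (fun x => (∫ y, φ y) • ψ x • f x) := i2.smul (∫ y, φ y)
    simp only [hχd, sub_smul, mul_smul] at h1
    rw [integral_sub i1 i3, integral_smul] at h1
    simp only [smul_sub]
    rw [integral_sub i1 (iφ.smul_const _), integral_smul_const]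
    exact h1
  exact key.mono fun x hx => sub_eq_zero.1 hx

/-- Functions in `H¹(ℝ)` have an absolutely continuous representative. -/
theorem HasWeakDeriv.exists_isPrimitive {u v : L2R} (h : HasWeakDeriv u v) :
    ∃ F : ℝ → ℂ, F =ᵐ[volume] u ∧ IsPrimitive F v := by
  have hv := v.locallyIntegrable
  have hP := IsPrimitive.of_integral hv.intervalIntegrable_real 0
  have hPl := hP.continuous.locallyIntegrable (μ := volume)
  obtain ⟨c, hc⟩ := ae_eq_const_of_integral_deriv_smul_eq_zero (u.locallyIntegrable.sub hPl)
    fun φ hφ hφc => by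
      have hd : Continuous (deriv φ) := hφ.continuous_deriv (by simp)
      simp only [Pi.sub_apply, smul_sub]
      rw [integral_sub (u.integrable_smul hd hφc.deriv)
        (hPl.integrable_smul_left_of_hasCompactSupport hd hφc.deriv), h φ hφ hφc,
        hP.integral_deriv_smul hφ hφc hv, sub_self]
  refine ⟨_, ?_, IsPrimitive.of_integral hv.intervalIntegrable_real c⟩
  filter_upwards [hc] with x hx
  rw [← hx]
  simp

theorem IsPrimitive.hasWeakDeriv {u v : L2R} {F : ℝ → ℂ} (h : IsPrimitive F v)
    (hF : F =ᵐ[volume] u) : HasWeakDeriv u v := by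
  intro φ hφ hφc
  rw [← h.integral_deriv_smul hφ hφc v.locallyIntegrable]
  exact integral_congr_ae (hF.mono fun x hx => by simp only [hx])

/-! ### The Green function and its reproducing property. -/

theorem integrable_exp_neg_mul_abs_sub {κ : ℝ} (hκ : 0 < κ) (y : ℝ) :
    Integrable (fun x : ℝ => Real.exp (-κ * |x - y|)) := by
  have h0 : Integrable (fun x : ℝ => Real.exp (-κ * |x|)) := by
    rw [← integrableOn_univ, ← Set.Iic_union_Ioi (a := (0 : ℝ))]
    refine IntegrableOn.union ?_ ?_
    · refine (integrableOn_exp_mul_Iic hκ 0).congr_fun (fun x hx => ?_) measurableSet_Iic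
      simp only [abs_of_nonpos (Set.mem_Iic.1 hx)]
      ring_nf
    · refine (integrableOn_exp_mul_Ioi (neg_lt_zero.2 hκ) 0).congr_fun (fun x hx => ?_)
        measurableSet_Ioi
      simp only [abs_of_pos (Set.mem_Ioi.1 hx)]
  exact h0.comp_sub_right y

theorem memLp_exp_neg_mul_abs_sub {κ : ℝ} (hκ : 0 < κ) (y : ℝ) :
    MemLp (fun x : ℝ => Real.exp (-κ * |x - y|)) 2 volume := by
  rw [memLp_two_iff_integrable_sq (by fun_prop)]
  refine (integrable_exp_neg_mul_abs_sub (mul_pos two_pos hκ) y).congr (ae_of_all _ fun x => ?_)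
  simp only [← Real.exp_nat_mul]
  ring_nf

/-- The derivative of `x ↦ exp (-κ |x - y|)`. -/
noncomputable def greenDeriv (κ y x : ℝ) : ℝ :=
  (if x ≤ y then κ else -κ) * Real.exp (-κ * |x - y|)

theorem memLp_greenDeriv {κ : ℝ} (hκ : 0 < κ) (y : ℝ) : MemLp (greenDeriv κ y) 2 volume := by
  refine ((memLp_exp_neg_mul_abs_sub hκ y).const_mul κ).mono ?_ (ae_of_all _ fun x => ?_)
  · refine Measurable.aestronglyMeasurable ?_
    exact (Measurable.ite measurableSet_Iic measurable_const measurable_const).mul (by fun_prop)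
  · unfold greenDeriv
    split_ifs <;> simp

theorem isPrimitive_exp_neg_mul_abs_sub {κ : ℝ} (hκ : 0 < κ) (y : ℝ) :
    IsPrimitive (fun x : ℝ => Real.exp (-κ * |x - y|)) (greenDeriv κ y) := by
  refine .of_hasDerivAt_off_countable (Set.countable_singleton y) (by fun_prop) (fun x hx => ?_)
    ((memLp_greenDeriv hκ y).locallyIntegrable (by norm_num)).intervalIntegrable_real
  have hd : ∀ s : ℝ, HasDerivAt (fun x : ℝ => Real.exp (s * (x - y)))
      (s * Real.exp (s * (x - y))) x := fun s => by
    exact ((((hasDerivAt_id' x).sub_const y).const_mul s).exp).congr_deriv (by ring)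
  rcases lt_or_gt_of_ne (fun h : x = y => hx h) with h | h
  · have e : ∀ z : ℝ, z < y → -κ * |z - y| = κ * (z - y) := fun z hz => by
      rw [abs_of_neg (sub_neg.2 hz)]; ring
    rw [greenDeriv, if_pos h.le, e x h]
    refine (hd κ).congr_of_eventuallyEq ?_
    filter_upwards [Iio_mem_nhds h] with z hz
    rw [e z hz]
  · have e : ∀ z : ℝ, y < z → -κ * |z - y| = -κ * (z - y) := fun z hz => by
      rw [abs_of_pos (sub_pos.2 hz)]
    rw [greenDeriv, if_neg (not_le.2 h), e x h]
    refine (hd (-κ)).congr_of_eventuallyEq ?_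
    filter_upwards [Ioi_mem_nhds h] with z hz
    rw [e z hz]

theorem L2R.coeFn_sum_smul {ι : Type*} (s : Finset ι) (c : ι → ℂ) (u : ι → L2R) :
    ⇑(∑ i ∈ s, c i • u i) =ᵐ[volume] fun x => ∑ i ∈ s, c i * u i x := by
  classical
  induction s using Finset.induction_on with
  | empty =>
    filter_upwards [Lp.coeFn_zero ℂ 2 (volume : Measure ℝ)] with x hx
    simp
  | insert i s hi ih =>
    rw [Finset.sum_insert hi]
    filter_upwards [ih, Lp.coeFn_add (c i • u i) (∑ j ∈ s, c j • u j),
      Lp.coeFn_smul (c i) (u i)] with x h1 h2 h3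
    rw [h2, Pi.add_apply, h1, h3, Finset.sum_insert hi, Pi.smul_apply, smul_eq_mul]

/-- The Green function of `-d²/dx² + κ²` with pole `y` reproduces point values at `y`. -/
theorem exists_green {κ : ℝ} (hκ : 0 < κ) (y : ℝ) :
    ∃ G G' : L2R, (fun x : ℝ => (Real.exp (-κ * |x - y|) : ℂ)) =ᵐ[volume] G ∧
      IsPrimitive (fun x : ℝ => (Real.exp (-κ * |x - y|) : ℂ)) G' ∧
      ∀ (u v : L2R) (F : ℝ → ℂ), F =ᵐ[volume] u → IsPrimitive F v →
        inner ℂ G' v + (κ : ℂ) ^ 2 * inner ℂ G u = 2 * κ * F y := by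
  have m1 : MemLp (fun x : ℝ => (Real.exp (-κ * |x - y|) : ℂ)) 2 volume :=
    (memLp_exp_neg_mul_abs_sub hκ y).ofReal
  have m2 : MemLp (fun x : ℝ => (greenDeriv κ y x : ℂ)) 2 volume := (memLp_greenDeriv hκ y).ofReal
  refine ⟨m1.toLp _, m2.toLp _, m1.coeFn_toLp.symm,
    (isPrimitive_exp_neg_mul_abs_sub hκ y).ofReal.congr_ae m2.coeFn_toLp.symm, ?_⟩
  intro u v F hF hv
  have i1 := L2.integrable_inner (𝕜 := ℂ) (m2.toLp _) v
  have i2 := L2.integrable_inner (𝕜 := ℂ) (m1.toLp _) u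
  have e1 : (fun x => inner ℂ ((m2.toLp _ : L2R) x) (v x))
      =ᵐ[volume] fun x => (greenDeriv κ y x : ℂ) * v x := by
    filter_upwards [m2.coeFn_toLp] with x hx
    rw [hx, RCLike.inner_apply, Complex.conj_ofReal, mul_comm]
  have e2 : (fun x => inner ℂ ((m1.toLp _ : L2R) x) (u x))
      =ᵐ[volume] fun x => (Real.exp (-κ * |x - y|) : ℂ) * F x := by
    filter_upwards [m1.coeFn_toLp, hF] with x hx hFx
    rw [hx, hFx, RCLike.inner_apply, Complex.conj_ofReal, mul_comm]
  rw [L2.inner_def, L2.inner_def, integral_congr_ae e1, integral_congr_ae e2]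
  replace i1 := i1.congr e1
  replace i2 := i2.congr e2
  rw [← integral_const_mul, ← integral_add i1 (i2.const_mul _)]
  have i3 : Integrable fun x => (greenDeriv κ y x : ℂ) * v x +
      (κ : ℂ) ^ 2 * ((Real.exp (-κ * |x - y|) : ℂ) * F x) := i1.add (i2.const_mul ((κ : ℂ) ^ 2))
  -- On each side of `y` the integrand is the derivative of s·e^{s(x-y)}·F(x), with s = κ on the
  -- left and s = -κ on the right. Each side contributes κ·F(y) at the pole, hence the factor 2κ.
  have hexp : ∀ s : ℝ, IsPrimitive (fun x : ℝ => ((s * Real.exp (s * (x - y)) : ℝ) : ℂ))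
      (fun x : ℝ => ((s * (s * Real.exp (s * (x - y))) : ℝ) : ℂ)) := fun s => by
    have hr : IsPrimitive (fun x : ℝ => s * Real.exp (s * (x - y)))
        (fun x : ℝ => s * (s * Real.exp (s * (x - y)))) := by
      refine IsPrimitive.of_hasDerivAt (fun x => ?_) (by fun_prop)
      exact (((((hasDerivAt_id' x).sub_const y).const_mul s).exp).const_mul s).congr_deriv (by ring)
    exact hr.ofReal
  rw [← intervalIntegral.integral_Iic_add_Ioi (b := y) i3.integrableOn i3.integrableOn]
  have cl : Set.EqOn (fun x => (greenDeriv κ y x : ℂ) * v x +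
      (κ : ℂ) ^ 2 * ((Real.exp (-κ * |x - y|) : ℂ) * F x))
      (fun x => ((κ * (κ * Real.exp (κ * (x - y))) : ℝ) : ℂ) * F x +
        ((κ * Real.exp (κ * (x - y)) : ℝ) : ℂ) * v x) (Set.Iic y) := by
    intro x hx
    have h1 : -κ * |x - y| = κ * (x - y) := by
      rw [abs_of_nonpos (sub_nonpos.2 hx)]; ring
    simp only [greenDeriv, if_pos (Set.mem_Iic.1 hx), h1]
    push_cast
    ring
  have cr : Set.EqOn (fun x => (greenDeriv κ y x : ℂ) * v x +
      (κ : ℂ) ^ 2 * ((Real.exp (-κ * |x - y|) : ℂ) * F x))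
      (fun x => ((-κ * (-κ * Real.exp (-κ * (x - y))) : ℝ) : ℂ) * F x +
        ((-κ * Real.exp (-κ * (x - y)) : ℝ) : ℂ) * v x) (Set.Ioi y) := by
    intro x hx
    have h1 : -κ * |x - y| = -κ * (x - y) := by
      rw [abs_of_pos (sub_pos.2 hx)]
    simp only [greenDeriv, if_neg (not_le.2 (Set.mem_Ioi.1 hx)), h1]
    push_cast
    ring
  have dl : IntegrableOn (fun x => ((κ * Real.exp (κ * (x - y)) : ℝ) : ℂ) * F x) (Set.Iic y) := by
    refine ((i2.const_mul (κ : ℂ)).integrableOn).congr_fun (fun x hx => ?_) measurableSet_Iic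
    have h1 : -κ * |x - y| = κ * (x - y) := by
      rw [abs_of_nonpos (sub_nonpos.2 hx)]; ring
    simp only [h1]
    push_cast
    ring
  have dr : IntegrableOn (fun x => ((-κ * Real.exp (-κ * (x - y)) : ℝ) : ℂ) * F x)
      (Set.Ioi y) := by
    refine ((i2.const_mul (-κ : ℂ)).integrableOn).congr_fun (fun x hx => ?_) measurableSet_Ioi
    have h1 : -κ * |x - y| = -κ * (x - y) := by
      rw [abs_of_pos (sub_pos.2 hx)]
    simp only [h1]
    push_cast
    ring
  rw [setIntegral_congr_fun measurableSet_Iic cl, setIntegral_congr_fun measurableSet_Ioi cr,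
    ((hexp κ).mul hv).integral_Iic (i3.integrableOn.congr_fun cl measurableSet_Iic) dl,
    ((hexp (-κ)).mul hv).integral_Ioi (i3.integrableOn.congr_fun cr measurableSet_Ioi) dr]
  simp
  ring

/-- Expand the nonnegative quantity ‖v - H'/(2κ)‖² + κ²‖u - H/(2κ)‖², where H = ∑ cᵢGᵢ combines
Green functions with poles `p i`. The reproducing property evaluates the cross term at the points,
and, applied to H itself, turns the square of H into the quadratic form of the matrix e^{-κ|pᵢ-pⱼ|}.
-/
theorem two_mul_re_sum_le {ι : Type*} [Fintype ι] (p : ι → ℝ) {κ : ℝ} (hκ : 0 < κ) (c : ι → ℂ)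
    {u v : L2R} {F : ℝ → ℂ} (hF : F =ᵐ[volume] u) (hv : IsPrimitive F v) :
    2 * (∑ i, starRingEnd ℂ (c i) * F (p i)).re ≤ ‖v‖ ^ 2 + κ ^ 2 * ‖u‖ ^ 2 +
      (2 * κ)⁻¹ * (∑ i, ∑ j, starRingEnd ℂ (c i) * c j *
        (Real.exp (-κ * |p i - p j|) : ℂ)).re := by
  choose G G' hG hG' hrep using fun i => exists_green hκ (p i)
  set H : L2R := ∑ i, c i • G i with hH
  set H' : L2R := ∑ i, c i • G' i with hH'
  have hrepH : ∀ (u v : L2R) (F : ℝ → ℂ), F =ᵐ[volume] u → IsPrimitive F v →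
      inner ℂ H' v + (κ : ℂ) ^ 2 * inner ℂ H u
        = 2 * κ * ∑ i, starRingEnd ℂ (c i) * F (p i) := by
    intro u v F hF hv
    simp only [hH, hH', sum_inner, inner_smul_left, Finset.mul_sum, ← Finset.sum_add_distrib]
    refine Finset.sum_congr rfl fun i _ => ?_
    linear_combination starRingEnd ℂ (c i) * hrep i u v F hF hv
  have e1 := hrepH u v F hF hv
  have e2 := hrepH H H' (fun x => ∑ j, c j * (Real.exp (-κ * |x - p j|) : ℂ)) ?_ ?_
  · have hpos : 0 ≤ ‖v - ((2 * κ : ℝ)⁻¹ : ℂ) • H'‖ ^ 2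
        + κ ^ 2 * ‖u - ((2 * κ : ℝ)⁻¹ : ℂ) • H‖ ^ 2 := by positivity
    have hs : ∀ a b : L2R, ‖a - ((2 * κ : ℝ)⁻¹ : ℂ) • b‖ ^ 2
        = ‖a‖ ^ 2 - κ⁻¹ * (inner ℂ b a).re + (2 * κ)⁻¹ ^ 2 * (inner ℂ b b).re := by
      intro a b
      rw [@norm_sub_sq ℂ, inner_smul_right, norm_smul, mul_pow, ← inner_conj_symm a b,
        ← @inner_self_eq_norm_sq ℂ _ _ _ _ b]
      have h1 : ‖(((2 * κ : ℝ)⁻¹ : ℝ) : ℂ)‖ = (2 * κ)⁻¹ := by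
        rw [Complex.norm_real, Real.norm_of_nonneg (by positivity)]
      rw [← Complex.ofReal_inv, h1]
      simp only [RCLike.re_to_complex, Complex.re_ofReal_mul, Complex.conj_re]
      field_simp
    have r1 := congrArg Complex.re e1
    have r2 := congrArg Complex.re e2
    have k2 : ((κ : ℂ) ^ 2) = ((κ ^ 2 : ℝ) : ℂ) := by push_cast; rfl
    have k1 : (2 * (κ : ℂ)) = ((2 * κ : ℝ) : ℂ) := by push_cast; rfl
    rw [k2, k1, Complex.add_re, Complex.re_ofReal_mul, Complex.re_ofReal_mul] at r1 r2
    rw [hs, hs] at hpos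
    have e3 : ∑ i, ∑ j, starRingEnd ℂ (c i) * c j * (Real.exp (-κ * |p i - p j|) : ℂ)
        = ∑ i, starRingEnd ℂ (c i) * ∑ j, c j * (Real.exp (-κ * |p i - p j|) : ℂ) := by
      simp only [Finset.mul_sum, mul_assoc]
    rw [e3]
    set S := (∑ i, starRingEnd ℂ (c i) * F (p i)).re
    set Q := (∑ i, starRingEnd ℂ (c i) * ∑ j, c j * (Real.exp (-κ * |p i - p j|) : ℂ)).re
    have f1 : κ⁻¹ * (2 * κ * S) = 2 * S := by field_simp
    have f2 : (2 * κ)⁻¹ ^ 2 * (2 * κ * Q) = (2 * κ)⁻¹ * Q := by field_simp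
    rw [← r1] at f1
    rw [← r2] at f2
    linarith
  · filter_upwards [L2R.coeFn_sum_smul Finset.univ c G, eventually_all.2 hG] with x hx hGx
    rw [hx]
    exact Finset.sum_congr rfl fun i _ => by rw [← hGx i]
  · refine (IsPrimitive.sum _ fun i _ => (hG' i).const_mul (c i)).congr_ae ?_
    exact (L2R.coeFn_sum_smul Finset.univ c G').symm

/-! ### Sums of largest eigenvalues of Hermitian matrices. -/

section

open Matrix ComplexOrder

/-- There is a matrix `0 ≤ Γ ≤ 1` of trace `k` with `s ≤ tr (A Γ)`; by the Ky Fan principle this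
says that the sum of the `k` largest eigenvalues of `A` is at least `s`. -/
def KyFanBound {ι : Type*} [Fintype ι] [DecidableEq ι] (A : Matrix ι ι ℂ) (k s : ℝ) : Prop :=
  ∃ Γ : Matrix ι ι ℂ, Γ.PosSemidef ∧ (1 - Γ).PosSemidef ∧ Γ.trace.re = k ∧ s ≤ (A * Γ).trace.re

theorem Matrix.PosSemidef.re_diag_nonneg {ι : Type*} {A : Matrix ι ι ℂ}
    (hA : A.PosSemidef) (i : ι) : 0 ≤ (A i i).re :=
  (Complex.le_def.1 (hA.diag_nonneg (i := i))).1

section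

variable {ι : Type*} [Fintype ι] [DecidableEq ι] {A B : Matrix ι ι ℂ} {k s : ℝ}

theorem kyFanBound_zero (A : Matrix ι ι ℂ) : KyFanBound A 0 0 :=
  ⟨0, .zero, by simpa using PosSemidef.one, by simp, by simp⟩

/-- Move the multiplier to the other factor: tr((A ⊙ B)Γ) = tr(A(Bᵀ ⊙ Γ)). By the Schur product
theorem Bᵀ ⊙ Γ is again a competitor, since the unit diagonal gives 1 - Bᵀ ⊙ Γ = Bᵀ ⊙ (1 - Γ) and
preserves the trace. -/
theorem KyFanBound.of_hadamard (hB : B.PosSemidef) (hd : ∀ i, B i i = 1)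
    (h : KyFanBound (A ⊙ B) k s) : KyFanBound A k s := by
  obtain ⟨Γ, h0, h1, hk, hs⟩ := h
  refine ⟨Bᵀ ⊙ Γ, hB.transpose.hadamard h0, ?_, ?_, ?_⟩
  · have e : 1 - Bᵀ ⊙ Γ = Bᵀ ⊙ (1 - Γ) := by
      ext i j
      rcases eq_or_ne i j with rfl | hij
      · simp [hd]
      · simp [hij]
    rw [e]
    exact hB.transpose.hadamard h1
  · rw [← hk]
    simp [Matrix.trace, hd]
  · refine hs.trans (le_of_eq ?_)
    simp only [Matrix.trace, Matrix.diag, Matrix.mul_apply, Matrix.hadamard_apply,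
      Matrix.transpose_apply, mul_assoc]

/-- A diagonalisation of a Hermitian matrix. -/
theorem Matrix.IsHermitian.exists_unitary (hA : A.IsHermitian) :
    ∃ (U : Matrix ι ι ℂ) (l : ι → ℝ), Uᴴ * U = 1 ∧ U * Uᴴ = 1 ∧
      A = U * diagonal (fun i => (l i : ℂ)) * Uᴴ := by
  refine ⟨hA.eigenvectorUnitary, hA.eigenvalues, ?_, ?_, ?_⟩
  · exact Unitary.coe_star_mul_self _
  · exact Unitary.coe_mul_star_self _
  · have := hA.spectral_theorem
    rw [Unitary.conjStarAlgAut_apply] at this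
    exact this

theorem trace_conj_diagonal_mul {U : Matrix ι ι ℂ} (l : ι → ℝ) (Γ : Matrix ι ι ℂ) :
    (U * diagonal (fun i => (l i : ℂ)) * Uᴴ * Γ).trace.re = ∑ i, l i * ((Uᴴ * Γ * U) i i).re := by
  have : (U * diagonal (fun i => (l i : ℂ)) * Uᴴ * Γ).trace
      = (diagonal (fun i => (l i : ℂ)) * (Uᴴ * Γ * U)).trace := by
    rw [mul_assoc, mul_assoc, Matrix.trace_mul_comm]
    simp only [mul_assoc]
  rw [this, Matrix.trace]
  simp [Matrix.diagonal_mul]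

theorem re_diag_mem_Icc {U Γ : Matrix ι ι ℂ} (hU : Uᴴ * U = 1) (h0 : Γ.PosSemidef)
    (h1 : (1 - Γ).PosSemidef) (i : ι) :
    0 ≤ ((Uᴴ * Γ * U) i i).re ∧ ((Uᴴ * Γ * U) i i).re ≤ 1 := by
  refine ⟨(h0.conjTranspose_mul_mul_same U).re_diag_nonneg i, ?_⟩
  have := (h1.conjTranspose_mul_mul_same U).re_diag_nonneg i
  rw [mul_sub, sub_mul, mul_one, hU] at this
  simpa using this

/-- In an eigenbasis of A, tr(AΓ) weights the nonnegative eigenvalues by diagonal entries of Γ,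
which are at most 1. -/
theorem KyFanBound.le_trace (hA : A.PosSemidef) (h : KyFanBound A k s) : s ≤ A.trace.re := by
  obtain ⟨Γ, h0, h1, hk, hs⟩ := h
  obtain ⟨U, l, hU, hU', rfl⟩ := hA.isHermitian.exists_unitary
  have hl : ∀ i, 0 ≤ l i := fun i => by
    have := (hA.conjTranspose_mul_mul_same U).re_diag_nonneg i
    rw [mul_assoc, mul_assoc, hU, mul_one, ← mul_assoc, hU, one_mul] at this
    simpa using this
  rw [trace_conj_diagonal_mul] at hs
  refine hs.trans ?_
  have e : (U * diagonal (fun i => (l i : ℂ)) * Uᴴ).trace.re = ∑ i, l i := by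
    have := trace_conj_diagonal_mul (U := U) l 1
    rw [mul_one, mul_one, hU] at this
    simpa using this
  rw [e]
  exact Finset.sum_le_sum fun i _ => mul_le_of_le_one_right (hl i) (re_diag_mem_Icc hU h0 h1 i).2

/-- If a Hermitian matrix is bounded below by `c` on an `m`-dimensional space, at least `m` of its
eigenvalues are at least `c`. -/
theorem card_le_of_form_ge {U : Matrix ι ι ℂ} (hU' : U * Uᴴ = 1) (l : ι → ℝ)
    {c : ℝ} {m : ℕ} (T : (Fin m → ℂ) →ₗ[ℂ] (ι → ℂ)) (hT : Function.Injective T)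
    (h : ∀ a, c * (star (T a) ⬝ᵥ T a).re ≤
      (star (T a) ⬝ᵥ ((U * diagonal (fun i => (l i : ℂ)) * Uᴴ) *ᵥ T a)).re) :
    m ≤ (Finset.univ.filter fun i => c ≤ l i).card := by
  classical
  -- `S` keeps the coordinates of `T a` along eigenvectors with eigenvalue at least `c`. If they all
  -- vanished for a nonzero vector, its form would be strictly below `c` times its squared norm.
  let S : (Fin m → ℂ) →ₗ[ℂ] ({i // c ≤ l i} → ℂ) :=
    (LinearMap.funLeft ℂ ℂ (Subtype.val : {i // c ≤ l i} → ι)) ∘ₗ Uᴴ.mulVecLin ∘ₗ T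
  have hS : Function.Injective S := by
    rw [← LinearMap.ker_eq_bot, LinearMap.ker_eq_bot']
    intro a ha
    set z := Uᴴ *ᵥ T a with hz
    have hz0 : ∀ i, c ≤ l i → z i = 0 := fun i hi => congrFun ha ⟨i, hi⟩
    have hTz : T a = U *ᵥ z := by rw [hz, mulVec_mulVec, hU', one_mulVec]
    have e1 : (star (T a) ⬝ᵥ T a).re = ∑ i, Complex.normSq (z i) := by
      have : star (T a) ⬝ᵥ T a = star z ⬝ᵥ z := by
        rw [hz, star_mulVec, conjTranspose_conjTranspose, ← dotProduct_mulVec, mulVec_mulVec, hU',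
          one_mulVec]
      rw [this]
      simp [dotProduct, Complex.normSq_apply]
    have e2 : (star (T a) ⬝ᵥ ((U * diagonal (fun i => (l i : ℂ)) * Uᴴ) *ᵥ T a)).re
        = ∑ i, l i * Complex.normSq (z i) := by
      have : star (T a) ⬝ᵥ ((U * diagonal (fun i => (l i : ℂ)) * Uᴴ) *ᵥ T a)
          = star z ⬝ᵥ (diagonal (fun i => (l i : ℂ)) *ᵥ z) := by
        rw [← mulVec_mulVec, ← mulVec_mulVec, ← hz, dotProduct_mulVec]
        conv_rhs => rw [hz, star_mulVec, conjTranspose_conjTranspose]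
      rw [this]
      simp [dotProduct, mulVec_diagonal, Complex.normSq_apply]
      refine Finset.sum_congr rfl fun i _ => ?_
      ring
    have h3 := h a
    rw [e1, e2, Finset.mul_sum] at h3
    have h4 : ∀ i, z i = 0 := by
      by_contra hne
      push Not at hne
      obtain ⟨i, hi⟩ := hne
      refine absurd h3 (not_le.2 (Finset.sum_lt_sum (fun j _ => ?_) ⟨i, Finset.mem_univ i, ?_⟩))
      · by_cases hj : c ≤ l j
        · simp [hz0 j hj]
        · exact mul_le_mul_of_nonneg_right (not_le.1 hj).le (Complex.normSq_nonneg _)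
      · have : ¬ c ≤ l i := fun hc => hi (hz0 i hc)
        exact mul_lt_mul_of_pos_right (not_le.1 this) (Complex.normSq_pos.2 hi)
    apply hT
    rw [map_zero, hTz, show z = 0 from funext h4, mulVec_zero]
  have := LinearMap.finrank_le_finrank_of_injective hS
  simpa [Fintype.card_subtype] using this

/-- At least k+1 eigenvalues of A are at least c, while Γ has trace only k. Hence one more unit of
trace fits onto those eigenvectors, and it raises tr(AΓ) by at least c. Only the diagonal of Γ in
the eigenbasis matters, so a new diagonal competitor suffices. -/
theorem KyFanBound.succ (hA : A.IsHermitian) {c : ℝ} {k : ℕ} (hk : KyFanBound A k s)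
    (T : (Fin (k + 1) → ℂ) →ₗ[ℂ] (ι → ℂ)) (hT : Function.Injective T)
    (h : ∀ a, c * (star (T a) ⬝ᵥ T a).re ≤ (star (T a) ⬝ᵥ (A *ᵥ T a)).re) :
    KyFanBound A (k + 1) (s + c) := by
  obtain ⟨Γ, h0, h1, hk, hs⟩ := hk
  obtain ⟨U, l, hU, hU', rfl⟩ := hA.exists_unitary
  have hcard := card_le_of_form_ge hU' l T hT h
  set J := Finset.univ.filter fun i => c ≤ l i with hJ
  set g : ι → ℝ := fun i => ((Uᴴ * Γ * U) i i).re with hg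
  have hg01 := re_diag_mem_Icc hU h0 h1
  have hsum : ∑ i, g i = k := by
    rw [← hk]
    have : Γ.trace = (Uᴴ * Γ * U).trace := by
      rw [Matrix.trace_mul_comm, ← mul_assoc, hU', one_mul]
    rw [this, Matrix.trace]
    simp [hg]
  -- `R` is the room left on `J`, at least (k+1) - k = 1. A unit of mass spread over `J` in
  -- proportion to `1 - g i` therefore keeps every entry at most 1.
  set R := ∑ i ∈ J, (1 - g i) with hR
  have hR1 : 1 ≤ R := by
    have e1 : R = J.card - ∑ i ∈ J, g i := by simp [hR]
    have e2 : ∑ i ∈ J, g i ≤ ∑ i, g i :=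
      Finset.sum_le_sum_of_subset_of_nonneg (Finset.subset_univ _) fun i _ _ => (hg01 i).1
    have e3 : ((k + 1 : ℕ) : ℝ) ≤ J.card := by exact_mod_cast hcard
    push_cast at e3
    linarith
  set d : ι → ℝ := fun i => g i + if i ∈ J then R⁻¹ * (1 - g i) else 0 with hd
  have hR0 : 0 < R := by linarith
  have hRi : R⁻¹ ≤ 1 := inv_le_one_of_one_le₀ hR1
  have hd0 : ∀ i, 0 ≤ d i := fun i => by
    simp only [hd]
    have := hg01 i
    split_ifs
    · have : 0 ≤ R⁻¹ * (1 - g i) := mul_nonneg (by positivity) (by linarith)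
      linarith
    · linarith
  have hd1 : ∀ i, d i ≤ 1 := fun i => by
    simp only [hd]
    have := hg01 i
    split_ifs
    · have : R⁻¹ * (1 - g i) ≤ 1 - g i := mul_le_of_le_one_left (by linarith) hRi
      linarith
    · linarith
  have hds : ∑ i, d i = k + 1 := by
    simp only [hd, Finset.sum_add_distrib, hsum, Finset.sum_ite_mem, Finset.univ_inter,
      ← Finset.mul_sum, ← hR]
    rw [inv_mul_cancel₀ hR0.ne']
  have hdl : s + c ≤ ∑ i, l i * d i := by
    rw [trace_conj_diagonal_mul] at hs
    simp only [hd, mul_add, Finset.sum_add_distrib, mul_ite, mul_zero, Finset.sum_ite_mem,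
      Finset.univ_inter]
    have : c ≤ ∑ i ∈ J, l i * (R⁻¹ * (1 - g i)) := by
      calc c = ∑ i ∈ J, c * (R⁻¹ * (1 - g i)) := by
            rw [← Finset.mul_sum, ← Finset.mul_sum, ← hR, inv_mul_cancel₀ hR0.ne', mul_one]
        _ ≤ _ := by
            refine Finset.sum_le_sum fun i hi => mul_le_mul_of_nonneg_right ?_ ?_
            · exact (Finset.mem_filter.1 hi).2
            · exact mul_nonneg (by positivity) (by linarith [(hg01 i).2])
    linarith
  have hconj : ∀ e : ι → ℝ, (∀ i, 0 ≤ e i) →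
      (U * diagonal (fun i => (e i : ℂ)) * Uᴴ).PosSemidef := fun e he =>
    (PosSemidef.diagonal fun i => by simpa using he i).mul_mul_conjTranspose_same U
  have hback : Uᴴ * (U * diagonal (fun i => (d i : ℂ)) * Uᴴ) * U = diagonal fun i => (d i : ℂ) := by
    rw [mul_assoc, mul_assoc, hU, mul_one, ← mul_assoc, hU, one_mul]
  refine ⟨U * diagonal (fun i => (d i : ℂ)) * Uᴴ, hconj d hd0, ?_, ?_, ?_⟩
  · convert hconj (fun i => 1 - d i) fun i => by linarith [hd1 i] using 1
    have : diagonal (fun i => ((1 - d i : ℝ) : ℂ)) = 1 - diagonal fun i => (d i : ℂ) := by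
      rw [← diagonal_one, diagonal_sub]
      simp
    rw [this, mul_sub, sub_mul, mul_one, hU']
  · have := trace_conj_diagonal_mul (U := U) d 1
    rw [mul_one, mul_one, hU] at this
    rw [this]
    simpa using hds
  · rw [trace_conj_diagonal_mul, hback]
    simpa using hdl

end

end

/-! ### Birman–Schwinger matrices of point interactions. -/

section

open Matrix ComplexOrder

/-- The matrix `exp (-κ |pᵢ - pⱼ|)`. -/
noncomputable def expDistMatrix {ι : Type*} (p : ι → ℝ) (κ : ℝ) : Matrix ι ι ℂ :=
  .of fun i j => (Real.exp (-κ * |p i - p j|) : ℂ)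

theorem expDistMatrix_isHermitian {ι : Type*} (p : ι → ℝ) (κ : ℝ) :
    (expDistMatrix p κ).IsHermitian := by
  ext i j
  simp only [expDistMatrix, conjTranspose_apply, of_apply, Complex.star_def, Complex.conj_ofReal,
    abs_sub_comm]

/-- For κ > 0 the completed square with u = 0 leaves exactly the quadratic form of this matrix. For
κ = 0 all entries are 1 and the matrix has rank at most one. -/
theorem expDistMatrix_posSemidef {ι : Type*} [Fintype ι] (p : ι → ℝ) {κ : ℝ} (hκ : 0 ≤ κ) :
    (expDistMatrix p κ).PosSemidef := by
  rcases hκ.eq_or_lt with rfl | hκ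
  · convert posSemidef_vecMulVec_self_star (fun _ : ι => (1 : ℂ)) using 1
    ext i j
    simp [expDistMatrix, vecMulVec_apply]
  refine .of_dotProduct_mulVec_nonneg (expDistMatrix_isHermitian p κ) fun c => ?_
  rw [Complex.le_def]
  refine ⟨?_, ((expDistMatrix_isHermitian p κ).im_star_dotProduct_mulVec_self c).symm⟩
  have h := two_mul_re_sum_le p hκ c (u := 0) (v := 0) (F := fun _ => 0)
    (Lp.coeFn_zero ℂ 2 (volume : Measure ℝ)).symm
    ((IsPrimitive.of_hasDerivAt (fun x => hasDerivAt_const x (0 : ℂ)) continuous_const).congr_ae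
      (Lp.coeFn_zero ℂ 2 (volume : Measure ℝ)).symm)
  simp only [mul_zero, Finset.sum_const_zero, Complex.zero_re, norm_zero, ne_eq, two_ne_zero,
    not_false_eq_true, zero_pow, add_zero, zero_add] at h
  have h' := nonneg_of_mul_nonneg_right h (inv_pos.2 (mul_pos two_pos hκ))
  refine h'.trans (le_of_eq ?_)
  simp only [dotProduct, mulVec, expDistMatrix, of_apply, Finset.mul_sum, Pi.star_apply,
    Complex.star_def]
  congr 1
  refine Finset.sum_congr rfl fun i _ => Finset.sum_congr rfl fun j _ => ?_
  ring

/-- The Birman–Schwinger matrix of the point interactions of strength `wᵢ` at `pᵢ`, at energy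
`-κ²`, normalised by the factor `2κ`. -/
noncomputable def birmanSchwingerMatrix {ι : Type*} (p w : ι → ℝ) (κ : ℝ) : Matrix ι ι ℂ :=
  .of fun i j => (√(w i) : ℂ) * (Real.exp (-κ * |p i - p j|) : ℂ) * (√(w j) : ℂ)

theorem birmanSchwingerMatrix_posSemidef {ι : Type*} [Fintype ι] (p w : ι → ℝ) {κ : ℝ}
    (hκ : 0 ≤ κ) : (birmanSchwingerMatrix p w κ).PosSemidef := by
  classical
  have h := (expDistMatrix_posSemidef p hκ).conjTranspose_mul_mul_same
    (diagonal fun i => (√(w i) : ℂ))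
  have e : (diagonal fun i => (√(w i) : ℂ))ᴴ * expDistMatrix p κ * (diagonal fun i => (√(w i) : ℂ))
      = birmanSchwingerMatrix p w κ := by
    ext i j
    simp [diagonal_conjTranspose, birmanSchwingerMatrix, expDistMatrix, Pi.star_def]
  rwa [e] at h

/-- Source of the monotonicity in κ: for κ' ≤ κ the multiplier is positive semidefinite with unit
diagonal. -/
theorem birmanSchwingerMatrix_hadamard {ι : Type*} (p w : ι → ℝ) (κ κ' : ℝ) :
    birmanSchwingerMatrix p w κ' ⊙ expDistMatrix p (κ - κ') = birmanSchwingerMatrix p w κ := by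
  ext i j
  have : Real.exp (-κ * |p i - p j|)
      = Real.exp (-κ' * |p i - p j|) * Real.exp (-(κ - κ') * |p i - p j|) := by
    rw [← Real.exp_add]; ring_nf
  simp only [birmanSchwingerMatrix, expDistMatrix, hadamard_apply, of_apply, this]
  push_cast
  ring

theorem birmanSchwingerMatrix_trace {ι : Type*} [Fintype ι] (p : ι → ℝ) {w : ι → ℝ}
    (hw : ∀ i, 0 ≤ w i) (κ : ℝ) : (birmanSchwingerMatrix p w κ).trace.re = ∑ i, w i := by
  simp [birmanSchwingerMatrix, Matrix.trace, ← Complex.ofReal_mul, Real.mul_self_sqrt (hw _)]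

/-- The Birman–Schwinger principle for point interactions. -/
theorem le_birmanSchwingerMatrix {ι : Type*} [Fintype ι] (p : ι → ℝ) {w : ι → ℝ}
    (hw : ∀ i, 0 ≤ w i) {κ : ℝ} (hκ : 0 < κ) {u v : L2R} {F : ℝ → ℂ} (hF : F =ᵐ[volume] u)
    (hv : IsPrimitive F v) (h : ‖v‖ ^ 2 + κ ^ 2 * ‖u‖ ^ 2 ≤ ∑ i, w i * ‖F (p i)‖ ^ 2)
    {y : ι → ℂ} (hy : y = fun i => (√(w i) : ℂ) * F (p i)) :
    2 * κ * (star y ⬝ᵥ y).re ≤ (star y ⬝ᵥ (birmanSchwingerMatrix p w κ *ᵥ y)).re := by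
  have hs : ∀ i, ((√(w i) : ℝ) : ℂ) * ((√(w i) : ℝ) : ℂ) = w i := fun i => by
    rw [← Complex.ofReal_mul, Real.mul_self_sqrt (hw i)]
  -- With cᵢ = wᵢF(pᵢ) the left side is twice the potential energy. The hypothesis `h` absorbs one
  -- copy into the norms, and the other is bounded by the matrix form divided by 2κ.
  have key := two_mul_re_sum_le p hκ (fun i => (w i : ℂ) * F (p i)) hF hv
  have hn : ∀ z : ℂ, starRingEnd ℂ z * z = ((‖z‖ ^ 2 : ℝ) : ℂ) := fun z => by
    rw [mul_comm, Complex.mul_conj, Complex.normSq_eq_norm_sq]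
  have e1 : (∑ i, starRingEnd ℂ ((w i : ℂ) * F (p i)) * F (p i)).re
      = ∑ i, w i * ‖F (p i)‖ ^ 2 := by
    simp only [map_mul, Complex.conj_ofReal, mul_assoc, hn, ← Complex.ofReal_mul,
      ← Complex.ofReal_sum, Complex.ofReal_re]
  have e2 : (star y ⬝ᵥ y).re = ∑ i, w i * ‖F (p i)‖ ^ 2 := by
    rw [← e1, hy]
    congr 1
    simp only [dotProduct, Pi.star_apply, Complex.star_def, map_mul, Complex.conj_ofReal]
    refine Finset.sum_congr rfl fun i _ => ?_
    rw [← hs i]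
    ring
  have e3 : star y ⬝ᵥ (birmanSchwingerMatrix p w κ *ᵥ y) = ∑ i, ∑ j,
      starRingEnd ℂ ((w i : ℂ) * F (p i)) * ((w j : ℂ) * F (p j)) *
        (Real.exp (-κ * |p i - p j|) : ℂ) := by
    rw [hy]
    simp only [dotProduct, mulVec, Pi.star_apply, Complex.star_def, map_mul, Complex.conj_ofReal,
      birmanSchwingerMatrix, of_apply, Finset.mul_sum]
    refine Finset.sum_congr rfl fun i _ => Finset.sum_congr rfl fun j _ => ?_
    rw [← hs i, ← hs j]
    ring
  rw [e1] at key
  rw [e2, e3]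
  have h3 : ∑ i, w i * ‖F (p i)‖ ^ 2 ≤ (2 * κ)⁻¹ * (∑ i, ∑ j,
      starRingEnd ℂ ((w i : ℂ) * F (p i)) * ((w j : ℂ) * F (p j)) *
        (Real.exp (-κ * |p i - p j|) : ℂ)).re := by linarith
  rwa [inv_mul_eq_div, le_div_iff₀ (by positivity), mul_comm] at h3

/-- The sharp Lieb–Thirring bound for point interactions, in variational form. -/
theorem two_mul_sum_le_sum_weights {ι : Type*} [Fintype ι] (p : ι → ℝ) {w : ι → ℝ}
    (hw : ∀ i, 0 ≤ w i) {n : ℕ} {κ : ℕ → ℝ} (hκ : ∀ k < n, 0 < κ k)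
    (hanti : ∀ j k, j ≤ k → k < n → κ k ≤ κ j) {u v : ℕ → L2R} {F : ℕ → ℝ → ℂ}
    (hF : ∀ k < n, F k =ᵐ[volume] u k) (hv : ∀ k < n, IsPrimitive (F k) (v k))
    (hu : ∀ k < n, ∀ a : Fin (k + 1) → ℂ, ∑ j, a j • u j = 0 → a = 0)
    (h : ∀ k < n, ∀ a : Fin (k + 1) → ℂ,
      ‖∑ j, a j • v j‖ ^ 2 + κ k ^ 2 * ‖∑ j, a j • u j‖ ^ 2
        ≤ ∑ i, w i * ‖∑ j, a j * F j (p i)‖ ^ 2) :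
    2 * ∑ k ∈ Finset.range n, κ k ≤ ∑ i, w i := by
  classical
  -- The bound is proved for every κ' below the first k values, so that the inductive hypothesis is
  -- available at κ' = κ k, where the next eigenvalue enters.
  have main : ∀ k ≤ n, ∀ κ' : ℝ, 0 < κ' → (∀ j < k, κ' ≤ κ j) →
      KyFanBound (birmanSchwingerMatrix p w κ') k (2 * ∑ j ∈ Finset.range k, κ j) := by
    intro k
    induction k with
    | zero =>
      intro _ κ' _ _
      simpa using kyFanBound_zero (birmanSchwingerMatrix p w κ')
    | succ k ih =>
      intro hk κ' hκ' hle
      have hkn : k < n := hk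
      have b1 := ih hkn.le (κ k) (hκ k hkn) fun j hj => hanti j k hj.le hkn
      let T : (Fin (k + 1) → ℂ) →ₗ[ℂ] (ι → ℂ) :=
        { toFun := fun a i => (√(w i) : ℂ) * ∑ j, a j * F j (p i)
          map_add' := fun a b => by
            ext i
            simp [add_mul, Finset.sum_add_distrib, mul_add]
          map_smul' := fun c a => by
            ext i
            simp only [Pi.smul_apply, smul_eq_mul, RingHom.id_apply, Finset.mul_sum]
            exact Finset.sum_congr rfl fun j _ => by ring }
      have hj : ∀ j : Fin (k + 1), (j : ℕ) < n := fun j => by omega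
      -- If the weighted point values all vanish, so does the potential energy; the form inequality
      -- with κ k > 0 then forces the linear combination itself to be 0.
      have hT : Function.Injective T := by
        rw [← LinearMap.ker_eq_bot, LinearMap.ker_eq_bot']
        intro a ha
        apply hu k hkn a
        have h1 := h k hkn a
        have h2 : ∑ i, w i * ‖∑ j, a j * F j (p i)‖ ^ 2 = 0 := by
          refine Finset.sum_eq_zero fun i _ => ?_
          have h3 : (√(w i) : ℂ) * ∑ j, a j * F j (p i) = 0 := congrFun ha i
          have h4 : √(w i) * ‖∑ j, a j * F j (p i)‖ = 0 := by
            have := congrArg norm h3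
            rwa [norm_mul, Complex.norm_real, Real.norm_of_nonneg (Real.sqrt_nonneg _),
              norm_zero] at this
          calc _ = (√(w i) * ‖∑ j, a j * F j (p i)‖) ^ 2 := by
                rw [mul_pow, Real.sq_sqrt (hw i)]
            _ = 0 := by rw [h4]; simp
        rw [h2] at h1
        have h5 : κ k ^ 2 * ‖∑ j, a j • u j‖ ^ 2 ≤ 0 := by
          linarith [sq_nonneg ‖∑ j, a j • v j‖]
        have h6 : ‖∑ j, a j • u j‖ ^ 2 ≤ 0 := by
          by_contra hc
          exact absurd h5 (not_le.2 (mul_pos (pow_pos (hκ k hkn) 2) (not_le.1 hc)))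
        exact norm_eq_zero.1 (pow_eq_zero_iff two_ne_zero |>.1 (le_antisymm h6 (sq_nonneg _)))
      have b2 := b1.succ (c := 2 * κ k)
        (birmanSchwingerMatrix_posSemidef p w (hκ k hkn).le).isHermitian T hT fun a =>
        le_birmanSchwingerMatrix p hw (hκ k hkn)
          (u := ∑ j, a j • u j) (v := ∑ j, a j • v j) (F := fun x => ∑ j, a j * F j x)
          (by
            filter_upwards [L2R.coeFn_sum_smul Finset.univ a fun j => u j,
              Filter.eventually_all.2 fun j : Fin (k + 1) => hF j (hj j)] with x hx hFx
            rw [hx]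
            exact Finset.sum_congr rfl fun i _ => by rw [hFx i])
          ((IsPrimitive.sum _ fun (j : Fin (k + 1)) _ => (hv j (hj j)).const_mul (a j)).congr_ae
            (L2R.coeFn_sum_smul Finset.univ a fun j => v j).symm)
          (h k hkn a) rfl
      -- The bound now holds at κ k; removing the Schur multiplier carries it down to κ'.
      rw [← birmanSchwingerMatrix_hadamard p w (κ k) κ'] at b2
      have b3 := b2.of_hadamard
        (expDistMatrix_posSemidef p (sub_nonneg.2 (hle k (Nat.lt_succ_self k))))
        fun i => by simp [expDistMatrix]
      rw [Finset.sum_range_succ, mul_add]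
      exact_mod_cast b3
  rcases Nat.eq_zero_or_pos n with rfl | hn
  · simpa using Finset.sum_nonneg fun i _ => hw i
  · have hl : n - 1 < n := Nat.sub_lt hn one_pos
    have b := main n le_rfl (κ (n - 1)) (hκ _ hl) fun j hj => hanti j _ (Nat.le_sub_one_of_lt hj) hl
    rw [← birmanSchwingerMatrix_trace p hw (κ (n - 1))]
    exact b.le_trace (birmanSchwingerMatrix_posSemidef p w (hκ _ hl).le)

end

/-! ### Approximation of a potential by point interactions. -/

theorem L2R.norm_sq_eq_integral (u : L2R) : ‖u‖ ^ 2 = ∫ x, ‖u x‖ ^ 2 := by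
  rw [← @inner_self_eq_norm_sq ℂ, L2.inner_def]
  have : ∀ x, inner ℂ (u x) (u x) = ((‖u x‖ ^ 2 : ℝ) : ℂ) := fun x => by
    rw [inner_self_eq_norm_sq_to_K]
    simp
  simp only [this]
  rw [integral_complex_ofReal]
  simp

theorem L2R.integrable_norm_sq (u : L2R) : Integrable fun x => ‖u x‖ ^ 2 :=
  (Lp.memLp u).integrable_norm_pow two_ne_zero

/-- The density `|u'|² + |u|²` controls the oscillation of `|u|²`. -/
theorem IsPrimitive.norm_sq_le {u v : L2R} {F : ℝ → ℂ} (hF : F =ᵐ[volume] u)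
    (hv : IsPrimitive F v) {s : Set ℝ} (hs : s.OrdConnected) {x y : ℝ} (hx : x ∈ s) (hy : y ∈ s) :
    ‖F x‖ ^ 2 ≤ ‖F y‖ ^ 2 + ∫ t in s, (‖v t‖ ^ 2 + ‖u t‖ ^ 2) := by
  have h := hv.conj.mul hv
  have hi : Integrable fun t => ‖v t‖ ^ 2 + ‖u t‖ ^ 2 :=
    v.integrable_norm_sq.add u.integrable_norm_sq
  have e : ∀ t, ((‖F t‖ ^ 2 : ℝ) : ℂ) = starRingEnd ℂ (F t) * F t := fun t => by
    rw [mul_comm, Complex.mul_conj, Complex.normSq_eq_norm_sq]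
  have h1 : ((‖F x‖ ^ 2 - ‖F y‖ ^ 2 : ℝ) : ℂ)
      = ∫ t in y..x, (starRingEnd ℂ (v t) * F t + starRingEnd ℂ (F t) * v t) := by
    rw [← h.sub_eq y x, Complex.ofReal_sub, e, e]
  have h2 : ‖F x‖ ^ 2 - ‖F y‖ ^ 2 ≤ ∫ t in s, (‖v t‖ ^ 2 + ‖u t‖ ^ 2) := by
    calc ‖F x‖ ^ 2 - ‖F y‖ ^ 2 ≤ ‖((‖F x‖ ^ 2 - ‖F y‖ ^ 2 : ℝ) : ℂ)‖ := by
          rw [Complex.norm_real]; exact le_abs_self _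
      _ ≤ ∫ t in Set.uIoc y x, ‖starRingEnd ℂ (v t) * F t + starRingEnd ℂ (F t) * v t‖ := by
          rw [h1]; exact intervalIntegral.norm_integral_le_integral_norm_uIoc
      _ ≤ ∫ t in Set.uIoc y x, (‖v t‖ ^ 2 + ‖u t‖ ^ 2) := by
          refine integral_mono_of_nonneg (ae_of_all _ fun t => norm_nonneg _) hi.integrableOn ?_
          filter_upwards [ae_restrict_of_ae hF] with t ht
          simp only [ht]
          refine (norm_add_le _ _).trans ?_
          simp only [norm_mul, RCLike.norm_conj]
          nlinarith [sq_nonneg (‖v t‖ - ‖u t‖)]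
      _ ≤ _ := by
          refine setIntegral_mono_set hi.integrableOn (ae_of_all _ fun t => by positivity)
            (LE.le.eventuallyLE ?_)
          exact Set.uIoc_subset_uIcc.trans (hs.uIcc_subset hy hx)
  linarith

theorem IsPrimitive.integrable_mul_norm_sq {u v : L2R} {F : ℝ → ℂ} (hF : F =ᵐ[volume] u)
    (hv : IsPrimitive F v) {W : ℝ → ℝ} (hW : Integrable W) :
    Integrable fun x => W x * ‖F x‖ ^ 2 := by
  have hc : Continuous fun x => ‖F x‖ ^ 2 := (hv.continuous.norm).pow 2
  refine hW.mul_bdd (c := ‖F 0‖ ^ 2 + ∫ t in Set.univ, (‖v t‖ ^ 2 + ‖u t‖ ^ 2))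
    hc.aestronglyMeasurable (ae_of_all _ fun x => ?_)
  rw [Real.norm_of_nonneg (by positivity)]
  exact hv.norm_sq_le hF Set.ordConnected_univ (Set.mem_univ _) (Set.mem_univ _)

/-- Inner regularity of the measure W dx: a compact subset of `s` lies between its minimum and
maximum, which belong to `s`. This handles cells that are unbounded or lack their endpoints. -/
theorem setIntegral_le_of_forall_Icc {W : ℝ → ℝ} (hW : Integrable W) (h0 : ∀ x, 0 ≤ W x)
    {s : Set ℝ} (hs : MeasurableSet s) {ε : ℝ} (hε : 0 ≤ ε)
    (h : ∀ a ∈ s, ∀ b ∈ s, a ≤ b → ∫ x in a..b, W x ≤ ε) : ∫ x in s, W x ≤ ε := by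
  let ν := (volume : Measure ℝ).withDensity fun x => ENNReal.ofReal (W x)
  have hfin : IsFiniteMeasure ν := isFiniteMeasure_withDensity_ofReal hW.2
  have hν : ∀ t, MeasurableSet t → ν t = ENNReal.ofReal (∫ x in t, W x) := fun t ht => by
    rw [withDensity_apply _ ht, ofReal_integral_eq_lintegral_ofReal hW.integrableOn
      (ae_of_all _ h0)]
  have : ν s ≤ ENNReal.ofReal ε := by
    rw [hs.measure_eq_iSup_isCompact_of_ne_top (measure_ne_top ν s)]
    refine iSup_le fun K => iSup_le fun hK => iSup_le fun hKc => ?_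
    rcases K.eq_empty_or_nonempty with rfl | hne
    · simp
    have ha := hKc.sInf_mem hne
    have hb := hKc.sSup_mem hne
    have hab : sInf K ≤ sSup K := csInf_le hKc.bddBelow hb
    have hsub : K ⊆ Set.Icc (sInf K) (sSup K) := fun x hx =>
      ⟨csInf_le hKc.bddBelow hx, le_csSup hKc.bddAbove hx⟩
    refine (measure_mono hsub).trans ?_
    rw [hν _ measurableSet_Icc, integral_Icc_eq_integral_Ioc,
      ← intervalIntegral.integral_of_le hab]
    exact ENNReal.ofReal_le_ofReal (h _ (hK ha) _ (hK hb) hab)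
  rw [hν s hs] at this
  exact (ENNReal.ofReal_le_ofReal_iff hε).1 this

/-- A nonnegative integrable potential is approximated, in the sense of forms, by finitely many
point interactions of the same total mass. -/
theorem exists_point_interactions {W : ℝ → ℝ} (hW : Integrable W) (h0 : ∀ x, 0 ≤ W x) {ε : ℝ}
    (hε : 0 < ε) :
    ∃ (N : ℕ) (p w : Fin N → ℝ), (∀ i, 0 ≤ w i) ∧ ∑ i, w i = ∫ x, W x ∧
      ∀ (u v : L2R) (F : ℝ → ℂ), F =ᵐ[volume] u → IsPrimitive F v →
        ∫ x, W x * ‖F x‖ ^ 2 ≤ ∑ i, w i * ‖F (p i)‖ ^ 2 + ε * (‖v‖ ^ 2 + ‖u‖ ^ 2) := by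
  classical
  let Φ : ℝ → ℝ := fun x => ∫ t in Set.Iic x, W t
  have hΦ0 : ∀ x, 0 ≤ Φ x := fun x => integral_nonneg h0
  have hΦm : Monotone Φ := fun x y hxy =>
    setIntegral_mono_set hW.integrableOn (ae_of_all _ h0)
      (LE.le.eventuallyLE (Set.Iic_subset_Iic.2 hxy))
  have hΦle : ∀ x, Φ x ≤ ∫ t, W t := fun x =>
    setIntegral_le_integral hW (ae_of_all _ h0)
  -- Cutting at the multiples of ε of the distribution function `Φ` gives finitely many
  -- order-connected cells of mass at most ε. On each cell |F|² oscillates by at most the H¹ energy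
  -- of that cell, and these energies add up.
  let idx : ℝ → ℕ := fun x => ⌊Φ x / ε⌋₊
  have hidx : Monotone idx := fun x y hxy =>
    Nat.floor_mono (div_le_div_of_nonneg_right (hΦm hxy) hε.le)
  let N : ℕ := ⌊(∫ t, W t) / ε⌋₊ + 1
  have hidxN : ∀ x, idx x < N := fun x =>
    Nat.lt_succ_of_le (Nat.floor_mono (div_le_div_of_nonneg_right (hΦle x) hε.le))
  let E : Fin N → Set ℝ := fun i => {x | idx x = i}
  have hEo : ∀ i, (E i).OrdConnected := fun i => by
    refine ⟨fun x hx y hy z hz => ?_⟩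
    exact le_antisymm ((hidx hz.2).trans_eq hy) ((Eq.ge hx).trans (hidx hz.1))
  have hEm : ∀ i, MeasurableSet (E i) := fun i => (hEo i).measurableSet
  have hEd : Pairwise (Function.onFun Disjoint E) := fun i j hij =>
    Set.disjoint_left.2 fun x hx hy => hij (Fin.ext ((Eq.symm hx).trans hy))
  have hEu : ⋃ i, E i = Set.univ := Set.eq_univ_of_forall fun x =>
    Set.mem_iUnion.2 ⟨⟨idx x, hidxN x⟩, rfl⟩
  have hsplit : ∀ f : ℝ → ℝ, Integrable f → ∫ x, f x = ∑ i, ∫ x in E i, f x := fun f hf => by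
    rw [← setIntegral_univ, ← hEu]
    have := integral_biUnion_finset (μ := volume) (f := f) Finset.univ (fun i _ => hEm i)
      (fun i _ j _ hij => hEd hij) (fun i _ => hf.integrableOn)
    simpa using this
  -- The default point 0 is harmless, since an empty cell gets weight 0.
  let p : Fin N → ℝ := fun i => if h : (E i).Nonempty then h.some else 0
  have hp : ∀ i, ∀ x ∈ E i, p i ∈ E i := fun i x hx => by
    have hne : (E i).Nonempty := ⟨x, hx⟩
    simp only [p, dif_pos hne]
    exact hne.some_mem
  have hmass : ∀ i, ∫ x in E i, W x ≤ ε := fun i => by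
    refine setIntegral_le_of_forall_Icc hW h0 (hEm i) hε.le fun a ha b hb hab => ?_
    rw [← intervalIntegral.integral_Iic_sub_Iic hW.integrableOn hW.integrableOn]
    have h1 : (i : ℝ) ≤ Φ a / ε := by
      have := Nat.floor_le (div_nonneg (hΦ0 a) hε.le)
      rwa [show ⌊Φ a / ε⌋₊ = (i : ℕ) from ha] at this
    have h2 : Φ b / ε < (i : ℝ) + 1 := by
      have := Nat.lt_floor_add_one (Φ b / ε)
      rwa [show ⌊Φ b / ε⌋₊ = (i : ℕ) from hb] at this
    rw [le_div_iff₀ hε] at h1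
    rw [div_lt_iff₀ hε] at h2
    change Φ b - Φ a ≤ ε
    linarith
  refine ⟨N, p, fun i => ∫ x in E i, W x, fun i => integral_nonneg h0, (hsplit W hW).symm, ?_⟩
  intro u v F hF hv
  have hi : Integrable fun t => ‖v t‖ ^ 2 + ‖u t‖ ^ 2 :=
    v.integrable_norm_sq.add u.integrable_norm_sq
  have hn : ‖v‖ ^ 2 + ‖u‖ ^ 2 = ∑ i, ∫ t in E i, (‖v t‖ ^ 2 + ‖u t‖ ^ 2) := by
    rw [← hsplit _ hi, integral_add v.integrable_norm_sq u.integrable_norm_sq,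
      ← L2R.norm_sq_eq_integral, ← L2R.norm_sq_eq_integral]
  rw [hsplit _ (hv.integrable_mul_norm_sq hF hW), hn, Finset.mul_sum, ← Finset.sum_add_distrib]
  refine Finset.sum_le_sum fun i _ => ?_
  calc ∫ x in E i, W x * ‖F x‖ ^ 2
      ≤ ∫ x in E i, W x * (‖F (p i)‖ ^ 2 + ∫ t in E i, (‖v t‖ ^ 2 + ‖u t‖ ^ 2)) := by
        refine setIntegral_mono_on (hv.integrable_mul_norm_sq hF hW).integrableOn
          (hW.mul_const _).integrableOn (hEm i) fun x hx => ?_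
        exact mul_le_mul_of_nonneg_left (hv.norm_sq_le hF (hEo i) hx (hp i x hx)) (h0 x)
    _ = (∫ x in E i, W x) * ‖F (p i)‖ ^ 2
        + (∫ x in E i, W x) * ∫ t in E i, (‖v t‖ ^ 2 + ‖u t‖ ^ 2) := by
        rw [integral_mul_const, mul_add]
    _ ≤ _ := by
        have : 0 ≤ ∫ t in E i, (‖v t‖ ^ 2 + ‖u t‖ ^ 2) := integral_nonneg fun t => by positivity
        gcongr
        exact hmass i

/-! ### From eigenfunctions of the Schrödinger operator to the upper bound. -/

theorem HasWeakDeriv.unique {u v v' : L2R} (h : HasWeakDeriv u v) (h' : HasWeakDeriv u v') :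
    v = v' := by
  have := h.add (h'.smul (-1))
  rw [neg_one_smul, neg_one_smul, ← sub_eq_add_neg, ← sub_eq_add_neg, sub_self] at this
  exact sub_eq_zero.1 this.eq_zero

theorem mem_opEigenspace_schrodingerOp {V : ℝ → ℝ} {μ : ℝ} {u : L2R} :
    u ∈ opEigenspace (schrodingerOp V) μ ↔ IsSchrodingerPair V u ((μ : ℂ) • u) := by
  rw [opEigenspace, schrodingerOp_graph]
  rfl

/-- The Schrödinger form is Hermitian, so the operator is symmetric. -/
theorem IsSchrodingerPair.inner_eq {V : ℝ → ℝ} {u w u₂ w₂ : L2R} (h : IsSchrodingerPair V u w)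
    (h₂ : IsSchrodingerPair V u₂ w₂) : inner ℂ u₂ w = inner ℂ w₂ u := by
  obtain ⟨v, hv, h⟩ := h
  obtain ⟨v₂, hv₂, h₂⟩ := h₂
  rw [← (h u₂ v₂ hv₂).2, ← inner_conj_symm w₂ u, ← (h₂ u v hv).2, map_add, inner_conj_symm,
    ← integral_conj]
  congr 2
  funext x
  simp only [potentialDensity, map_mul, Complex.conj_ofReal, Complex.conj_conj]
  ring

theorem inner_eq_zero_of_mem_opEigenspace {V : ℝ → ℝ} {μ μ₂ : ℝ} (hne : μ ≠ μ₂) {u u₂ : L2R}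
    (h : u ∈ opEigenspace (schrodingerOp V) μ) (h₂ : u₂ ∈ opEigenspace (schrodingerOp V) μ₂) :
    inner ℂ u₂ u = 0 := by
  have := (mem_opEigenspace_schrodingerOp.1 h).inner_eq (mem_opEigenspace_schrodingerOp.1 h₂)
  rw [inner_smul_right, inner_smul_left, Complex.conj_ofReal] at this
  by_contra h0
  exact hne (Complex.ofReal_injective (mul_right_cancel₀ h0 this))

theorem MeasureTheory.Integrable.negPart_real {V : ℝ → ℝ} (hV : Integrable V) :
    Integrable fun x => (V x)⁻ := by
  simpa [negPart_def] using hV.neg_part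

/-- The form inequality satisfied by the elements of the domain. -/
theorem IsSchrodingerPair.form_le {V : ℝ → ℝ} (hV : Integrable V) {u v w : L2R} {F : ℝ → ℂ}
    (h : IsSchrodingerPair V u w) (hF : F =ᵐ[volume] u) (hv : IsPrimitive F v) :
    ‖v‖ ^ 2 ≤ (∫ x, (V x)⁻ * ‖F x‖ ^ 2) + (inner ℂ u w).re := by
  obtain ⟨v', hv', h⟩ := h
  obtain rfl := hv'.unique (hv.hasWeakDeriv hF)
  obtain ⟨-, he⟩ := h u v' hv'
  have e1 : ∫ x, potentialDensity V u u x = ((∫ x, V x * ‖F x‖ ^ 2 : ℝ) : ℂ) := by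
    rw [← integral_complex_ofReal]
    refine integral_congr_ae (hF.mono fun x hx => ?_)
    simp only [potentialDensity, hx]
    rw [mul_comm (starRingEnd ℂ _), Complex.mul_conj, Complex.normSq_eq_norm_sq]
    push_cast
    rfl
  have e2 := congrArg Complex.re he
  rw [e1, Complex.add_re, Complex.ofReal_re] at e2
  have e3 : (inner ℂ v' v').re = ‖v'‖ ^ 2 := @inner_self_eq_norm_sq ℂ _ _ _ _ v'
  have e4 : 0 ≤ (∫ x, V x * ‖F x‖ ^ 2) + ∫ x, (V x)⁻ * ‖F x‖ ^ 2 := by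
    rw [← integral_add (hv.integrable_mul_norm_sq hF hV) (hv.integrable_mul_norm_sq hF hV.negPart_real)]
    refine integral_nonneg fun x => ?_
    have : 0 ≤ V x + (V x)⁻ := by
      have := posPart_sub_negPart (V x)
      linarith [posPart_nonneg (V x)]
    change 0 ≤ V x * ‖F x‖ ^ 2 + (V x)⁻ * ‖F x‖ ^ 2
    rw [← add_mul]
    positivity
  linarith

theorem sum_le_of_orthonormal_antitone {V : ℝ → ℝ} (hV : Integrable V) {n : ℕ} {u : ℕ → L2R}
    {κ : ℕ → ℝ} (hκ : ∀ k < n, 0 < κ k) (hanti : ∀ j k, j ≤ k → k < n → κ k ≤ κ j)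
    (ho : Orthonormal ℂ fun k : Fin n => u k)
    (hu : ∀ k < n, u k ∈ opEigenspace (schrodingerOp V) (-(κ k) ^ 2)) :
    ∑ k ∈ Finset.range n, κ k ≤ 1 / 2 * ∫ x, (V x)⁻ := by
  have hex : ∀ k, ∃ (v : L2R) (F : ℝ → ℂ), k < n → F =ᵐ[volume] u k ∧ IsPrimitive F v := by
    intro k
    by_cases hk : k < n
    · obtain ⟨v, hv, -⟩ := mem_opEigenspace_schrodingerOp.1 (hu k hk)
      obtain ⟨F, hF⟩ := hv.exists_isPrimitive
      exact ⟨v, F, fun _ => hF⟩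
    · exact ⟨0, 0, fun h => absurd h hk⟩
  choose v F hvF using hex
  have hsub : ∀ k < n, Orthonormal ℂ fun j : Fin (k + 1) => u j := fun k hk =>
    ho.comp (Fin.castLE (Nat.succ_le_of_lt hk)) (Fin.castLE_injective _)
  have hrepr : ∀ k < n, ∀ a : Fin (k + 1) → ℂ,
      (fun x => ∑ j, a j * F j x) =ᵐ[volume] ⇑(∑ j, a j • u j) ∧
        IsPrimitive (fun x => ∑ j, a j * F j x) ⇑(∑ j, a j • v j) := by
    intro k hk a
    have hj : ∀ j : Fin (k + 1), (j : ℕ) < n := fun j => by omega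
    refine ⟨?_, (IsPrimitive.sum _ fun (j : Fin (k + 1)) _ =>
      (hvF j (hj j)).2.const_mul (a j)).congr_ae
        (L2R.coeFn_sum_smul Finset.univ a fun j => v j).symm⟩
    filter_upwards [L2R.coeFn_sum_smul Finset.univ a fun j => u j,
      Filter.eventually_all.2 fun j : Fin (k + 1) => (hvF j (hj j)).1] with x hx hFx
    rw [hx]
    exact Finset.sum_congr rfl fun i _ => by rw [hFx i]
  -- On the span of the first k+1 eigenfunctions the energy is at most -κₖ² times the squared norm,
  -- by orthonormality and the ordering of the κ's.
  have hform : ∀ k < n, ∀ a : Fin (k + 1) → ℂ,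
      ‖∑ j, a j • v j‖ ^ 2 + κ k ^ 2 * ‖∑ j, a j • u j‖ ^ 2
        ≤ ∫ x, (V x)⁻ * ‖∑ j, a j * F j x‖ ^ 2 := by
    intro k hk a
    have hj : ∀ j : Fin (k + 1), (j : ℕ) < n := fun j => by omega
    have hpair : IsSchrodingerPair V (∑ j, a j • u j)
        (∑ j : Fin (k + 1), (a j * (-(κ j) ^ 2 : ℝ)) • u j) := by
      have : (∑ j : Fin (k + 1), a j • (u j, (((-(κ j) ^ 2 : ℝ)) : ℂ) • u j))
          ∈ schrodingerGraph V :=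
        Submodule.sum_mem _ fun j _ => Submodule.smul_mem _ _
          (mem_opEigenspace_schrodingerOp.1 (hu j (hj j)))
      have e : (∑ j : Fin (k + 1), a j • (u j, (((-(κ j) ^ 2 : ℝ)) : ℂ) • u j))
          = (∑ j, a j • u j, ∑ j : Fin (k + 1), (a j * (-(κ j) ^ 2 : ℝ)) • u j) := by
        simp only [Prod.ext_iff, Prod.fst_sum, Prod.snd_sum, Prod.smul_mk, mul_smul, and_self]
      rw [e] at this
      exact this
    have h1 := hpair.form_le hV (hrepr k hk a).1 (hrepr k hk a).2
    have e1 : ‖∑ j, a j • u j‖ ^ 2 = ∑ j, ‖a j‖ ^ 2 := by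
      rw [← @inner_self_eq_norm_sq ℂ, (hsub k hk).inner_sum]
      simp only [← Complex.normSq_eq_conj_mul_self, Complex.normSq_eq_norm_sq,
        ← Complex.ofReal_sum, RCLike.re_to_complex, Complex.ofReal_re]
    have e2 : (inner ℂ (∑ j, a j • u j)
        (∑ j : Fin (k + 1), (a j * (-(κ j) ^ 2 : ℝ)) • u j)).re = - ∑ j : Fin (k + 1), κ j ^ 2 * ‖a j‖ ^ 2 := by
      rw [(hsub k hk).inner_sum, ← Finset.sum_neg_distrib, Complex.re_sum]
      refine Finset.sum_congr rfl fun j _ => ?_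
      rw [← mul_assoc, ← Complex.normSq_eq_conj_mul_self, Complex.normSq_eq_norm_sq,
        ← Complex.ofReal_mul, Complex.ofReal_re]
      ring
    have e3 : κ k ^ 2 * ∑ j, ‖a j‖ ^ 2 ≤ ∑ j : Fin (k + 1), κ j ^ 2 * ‖a j‖ ^ 2 := by
      rw [Finset.mul_sum]
      refine Finset.sum_le_sum fun j _ => mul_le_mul_of_nonneg_right ?_ (sq_nonneg _)
      exact pow_le_pow_left₀ (hκ k hk).le (hanti j k (by omega) hk) 2
    rw [e1]
    linarith
  have hind : ∀ k < n, ∀ a : Fin (k + 1) → ℂ, ∑ j, a j • u j = 0 → a = 0 := fun k hk a ha =>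
    funext (Fintype.linearIndependent_iff.1 (hsub k hk).linearIndependent a ha)
  -- The error ε(‖v‖² + ‖u‖²) is moved to the left: κ² drops to κ² - ε, and division by 1 - ε
  -- restores the coefficient of ‖v‖² while rescaling the weights.
  have key : ∀ ε : ℝ, 0 < ε → ε < 1 → (∀ k < n, ε < κ k ^ 2) →
      ∑ k ∈ Finset.range n, √(κ k ^ 2 - ε) ≤ 1 / 2 * ((∫ x, (V x)⁻) / (1 - ε)) := by
    intro ε hε hε1 hεκ
    obtain ⟨N, p, w, hw, hws, hW⟩ := exists_point_interactions hV.negPart_real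
      (fun x => negPart_nonneg (V x)) hε
    have h1ε : 0 < 1 - ε := sub_pos.2 hε1
    have h := two_mul_sum_le_sum_weights p (w := fun i => w i / (1 - ε))
      (fun i => div_nonneg (hw i) h1ε.le) (n := n) (κ := fun k => √(κ k ^ 2 - ε))
      (fun k hk => Real.sqrt_pos.2 (sub_pos.2 (hεκ k hk)))
      (fun j k hjk hk => Real.sqrt_le_sqrt (sub_le_sub_right
        (pow_le_pow_left₀ (hκ k hk).le (hanti j k hjk hk) 2) _))
      (u := u) (v := v) (F := F) (fun k hk => (hvF k hk).1) (fun k hk => (hvF k hk).2) hind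
      (fun k hk a => by
        have h1 := hform k hk a
        have h2 := hW _ _ _ (hrepr k hk a).1 (hrepr k hk a).2
        simp only [div_mul_eq_mul_div, ← Finset.sum_div]
        rw [le_div_iff₀ h1ε, Real.sq_sqrt (sub_pos.2 (hεκ k hk)).le]
        -- The division would give (κ² - ε)/(1 - ε); this term pays for keeping only κ² - ε.
        have h3 : 0 ≤ ε * ((κ k ^ 2 - ε) * ‖∑ j, a j • u j‖ ^ 2) :=
          mul_nonneg hε.le (mul_nonneg (sub_pos.2 (hεκ k hk)).le (sq_nonneg _))
        nlinarith)
    rw [← Finset.sum_div, hws] at h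
    linarith
  have hlim : Tendsto (fun ε : ℝ => ∑ k ∈ Finset.range n, √(κ k ^ 2 - ε)) (𝓝[>] 0)
      (𝓝 (∑ k ∈ Finset.range n, κ k)) := by
    have hc : Continuous fun ε : ℝ => ∑ k ∈ Finset.range n, √(κ k ^ 2 - ε) := by fun_prop
    have := (hc.tendsto 0).mono_left (nhdsWithin_le_nhds (s := Set.Ioi 0))
    convert this using 2
    refine Finset.sum_congr rfl fun k hk => ?_
    rw [sub_zero, Real.sqrt_sq (hκ k (Finset.mem_range.1 hk)).le]
  have hlim' : Tendsto (fun ε : ℝ => 1 / 2 * ((∫ x, (V x)⁻) / (1 - ε))) (𝓝[>] 0)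
      (𝓝 (1 / 2 * ∫ x, (V x)⁻)) := by
    have : ContinuousAt (fun ε : ℝ => 1 / 2 * ((∫ x, (V x)⁻) / (1 - ε))) 0 := by
      refine ContinuousAt.mul continuousAt_const (ContinuousAt.div continuousAt_const ?_ (by simp))
      fun_prop
    have := this.tendsto.mono_left (nhdsWithin_le_nhds (s := Set.Ioi 0))
    simpa using this
  refine le_of_tendsto_of_tendsto hlim hlim' ?_
  have hev : ∀ᶠ ε : ℝ in 𝓝[>] 0, ∀ k ∈ Finset.range n, ε < κ k ^ 2 :=
    (Filter.eventually_all_finset _).2 fun k hk =>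
      mem_nhdsWithin_of_mem_nhds (Iio_mem_nhds (pow_pos (hκ k (Finset.mem_range.1 hk)) 2))
  filter_upwards [self_mem_nhdsWithin, mem_nhdsWithin_of_mem_nhds (Iio_mem_nhds one_pos), hev]
    with ε h0 h1 h2
  exact key ε h0 h1 fun k hk => h2 k (Finset.mem_range.2 hk)

theorem sum_le_of_orthonormal {V : ℝ → ℝ} (hV : Integrable V) {ι : Type*} [Fintype ι]
    {u : ι → L2R} {κ : ι → ℝ} (hκ : ∀ i, 0 < κ i) (ho : Orthonormal ℂ u)
    (hu : ∀ i, u i ∈ opEigenspace (schrodingerOp V) (-(κ i) ^ 2)) :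
    ∑ i, κ i ≤ 1 / 2 * ∫ x, (V x)⁻ := by
  let e₀ : Fin (Fintype.card ι) ≃ ι := (Fintype.equivFin ι).symm
  -- `Tuple.sort` sorts increasingly, so the sign produces decreasing κ.
  let e : Fin (Fintype.card ι) ≃ ι := (Tuple.sort fun i => -κ (e₀ i)).trans e₀
  have he : Monotone fun i => -κ (e i) := Tuple.monotone_sort fun i => -κ (e₀ i)
  let κ' : ℕ → ℝ := fun k => if h : k < Fintype.card ι then κ (e ⟨k, h⟩) else 0
  let u' : ℕ → L2R := fun k => if h : k < Fintype.card ι then u (e ⟨k, h⟩) else 0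
  have hκ' : ∀ k (hk : k < Fintype.card ι), κ' k = κ (e ⟨k, hk⟩) := fun k hk => dif_pos hk
  have hu' : ∀ k (hk : k < Fintype.card ι), u' k = u (e ⟨k, hk⟩) := fun k hk => dif_pos hk
  have h := sum_le_of_orthonormal_antitone hV (n := Fintype.card ι) (u := u') (κ := κ')
    (fun k hk => by rw [hκ' k hk]; exact hκ _)
    (fun j k hjk hk => by
      rw [hκ' k hk, hκ' j (hjk.trans_lt hk)]
      exact neg_le_neg_iff.1 (he (Fin.mk_le_mk.2 hjk)))
    (by
      have : (fun k : Fin (Fintype.card ι) => u' k) = u ∘ e := funext fun k => hu' k k.2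
      rw [this]
      exact ho.comp e e.injective)
    (fun k hk => by rw [hκ' k hk, hu' k hk]; exact hu _)
  rw [Finset.sum_range, ← e.sum_comp] at *
  simpa [hκ'] using h

theorem exists_orthonormal_of_le_eigenMultiplicity {H : L2R →ₗ.[ℂ] L2R} {μ : ℝ} {m : ℕ}
    (h : (m : ℕ∞) ≤ eigenMultiplicity H μ) :
    ∃ u : Fin m → L2R, Orthonormal ℂ u ∧ ∀ i, u i ∈ opEigenspace H μ := by
  rw [eigenMultiplicity, Cardinal.natCast_le_toENat] at h
  obtain ⟨s, hs, hli⟩ := le_rank_iff_exists_linearIndependent_finset.1 h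
  let e : Fin m ≃ s := (finCongr hs.symm).trans s.equivFin.symm
  have hli' : LinearIndependent ℂ fun i => (e i : opEigenspace H μ) := hli.comp e e.injective
  have ho := InnerProductSpace.gramSchmidtNormed_orthonormal hli'
  exact ⟨_, ho.comp_linearIsometry (opEigenspace H μ).subtypeₗᵢ, fun i => Subtype.prop _⟩

/-- Eigenvectors for different eigenvalues are orthogonal, so orthonormal families in the
eigenspaces join into one. Only a lower bound on the multiplicities is used, which makes the
estimate available before they are known to be finite. -/
theorem sum_mul_sqrt_le {V : ℝ → ℝ} (hV : Integrable V) (s : Finset (Set.Iio (0 : ℝ)))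
    {m : Set.Iio (0 : ℝ) → ℕ}
    (hm : ∀ μ ∈ s, (m μ : ℕ∞) ≤ eigenMultiplicity (schrodingerOp V) μ) :
    ∑ μ ∈ s, m μ * |(μ : ℝ)| ^ (1 / 2 : ℝ) ≤ 1 / 2 * ∫ x, (V x)⁻ := by
  choose! u hu using fun μ hμ => exists_orthonormal_of_le_eigenMultiplicity (hm μ hμ)
  let U : (Σ μ : s, Fin (m μ)) → L2R := fun i => u i.1 i.2
  have hne : ∀ μ : Set.Iio (0 : ℝ), 0 < |(μ : ℝ)| := fun μ => abs_pos.2 (ne_of_lt μ.2)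
  have h := sum_le_of_orthonormal hV (u := U) (κ := fun i => |(i.1.1 : ℝ)| ^ (1 / 2 : ℝ))
    (fun i => Real.rpow_pos_of_pos (hne _) _) ?_ ?_
  · rw [Fintype.sum_sigma] at h
    simp only [Finset.sum_const, Finset.card_univ, Fintype.card_fin, nsmul_eq_mul] at h
    rwa [Finset.sum_coe_sort s fun μ => (m μ : ℝ) * |(μ : ℝ)| ^ (1 / 2 : ℝ)] at h
  · refine ⟨fun i => (hu _ i.1.2).1.1 i.2, ?_⟩
    rintro ⟨μ, i⟩ ⟨μ', j⟩ hij
    rcases eq_or_ne μ μ' with rfl | hμ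
    · exact (hu _ μ.2).1.2 fun hc => hij (congrArg (Sigma.mk μ) hc)
    · exact inner_eq_zero_of_mem_opEigenspace
        (fun hc => hμ (Subtype.ext (Subtype.ext hc)).symm) ((hu _ μ'.2).2 j) ((hu _ μ.2).2 i)
  · rintro ⟨μ, i⟩
    have e : -(|(μ.1 : ℝ)| ^ (1 / 2 : ℝ)) ^ 2 = μ.1 := by
      rw [← Real.sqrt_eq_rpow, Real.sq_sqrt (abs_nonneg _), abs_of_neg μ.1.2, neg_neg]
    change u μ i ∈ opEigenspace (schrodingerOp V) (-(|(μ.1 : ℝ)| ^ (1 / 2 : ℝ)) ^ 2)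
    rw [e]
    exact (hu _ μ.2).2 i

theorem negEigenvalueSum_le {V : ℝ → ℝ} (hV : Integrable V) :
    negEigenvalueSum (schrodingerOp V) (1 / 2) ≤ ENNReal.ofReal (1 / 2 * ∫ x, (V x)⁻) := by
  have hne : ∀ μ : Set.Iio (0 : ℝ), 0 < |(μ : ℝ)| ^ (1 / 2 : ℝ) := fun μ =>
    Real.rpow_pos_of_pos (abs_pos.2 (ne_of_lt μ.2)) _
  have hfin : ∀ μ : Set.Iio (0 : ℝ), eigenMultiplicity (schrodingerOp V) μ ≠ ⊤ := by
    intro μ htop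
    obtain ⟨m, hm⟩ := exists_nat_gt ((1 / 2 * ∫ x, (V x)⁻) / |(μ : ℝ)| ^ (1 / 2 : ℝ))
    have := sum_mul_sqrt_le hV {μ} (m := fun _ => m) (by simp [htop])
    rw [Finset.sum_singleton] at this
    rw [div_lt_iff₀ (hne μ)] at hm
    linarith
  rw [negEigenvalueSum, ENNReal.tsum_eq_iSup_sum]
  refine iSup_le fun s => ?_
  have h := sum_mul_sqrt_le hV s
    (m := fun μ => (eigenMultiplicity (schrodingerOp V) μ).toNat)
    fun μ _ => (ENat.natCast_toNat (hfin μ)).le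
  refine le_trans (le_of_eq ?_) (ENNReal.ofReal_le_ofReal h)
  rw [ENNReal.ofReal_sum_of_nonneg fun μ _ => mul_nonneg (Nat.cast_nonneg _) (hne μ).le]
  refine Finset.sum_congr rfl fun μ _ => ?_
  rw [ENNReal.ofReal_mul (Nat.cast_nonneg _), ENNReal.ofReal_natCast]
  conv_lhs => rw [← ENat.natCast_toNat (hfin μ), ENat.toENNReal_coe]

/-! ### Sharpness: the potentials -ν(ν+1)/cosh². -/

theorem exp_abs_le_two_mul_cosh (x : ℝ) : Real.exp |x| ≤ 2 * Real.cosh x := by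
  rw [← Real.cosh_abs, Real.cosh_eq]
  linarith [Real.exp_pos (-|x|)]

theorem cosh_rpow_neg_le {ν : ℝ} (hν : 0 ≤ ν) (x : ℝ) :
    Real.cosh x ^ (-ν) ≤ 2 ^ ν * Real.exp (-ν * |x - 0|) := by
  have h1 : Real.exp |x| / 2 ≤ Real.cosh x := by linarith [exp_abs_le_two_mul_cosh x]
  calc Real.cosh x ^ (-ν) ≤ (Real.exp |x| / 2) ^ (-ν) :=
        Real.rpow_le_rpow_of_nonpos (by positivity) h1 (by linarith)
    _ = _ := by
        rw [Real.div_rpow (Real.exp_pos _).le zero_le_two, ← Real.exp_mul, Real.rpow_neg zero_le_two,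
          div_inv_eq_mul, sub_zero]
        ring_nf

theorem continuous_cosh_rpow (a : ℝ) : Continuous fun x => Real.cosh x ^ a :=
  Real.continuous_cosh.rpow_const fun x => Or.inl (Real.cosh_pos x).ne'

theorem memLp_cosh_rpow {ν : ℝ} (hν : 0 < ν) :
    MemLp (fun x => Real.cosh x ^ (-ν)) 2 volume := by
  refine ((memLp_exp_neg_mul_abs_sub hν 0).const_mul (2 ^ ν)).mono
    (continuous_cosh_rpow _).aestronglyMeasurable (ae_of_all _ fun x => ?_)
  rw [Real.norm_of_nonneg (Real.rpow_nonneg (Real.cosh_pos x).le _),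
    Real.norm_of_nonneg (by positivity)]
  exact cosh_rpow_neg_le hν.le x

theorem hasDerivAt_cosh_rpow (a x : ℝ) : HasDerivAt (fun x => Real.cosh x ^ a)
    (a * Real.sinh x * Real.cosh x ^ (a - 1)) x :=
  ((Real.hasDerivAt_cosh x).rpow_const (Or.inl (Real.cosh_pos x).ne')).congr_deriv (by ring)

/-- The ground state of the potential `-ν (ν + 1) / cosh²` solves its Schrödinger equation. -/
theorem hasDerivAt_sinh_mul_cosh_rpow (ν x : ℝ) :
    HasDerivAt (fun x => -ν * Real.sinh x * Real.cosh x ^ (-ν - 1))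
      (ν ^ 2 * Real.cosh x ^ (-ν) + -(ν * (ν + 1)) / Real.cosh x ^ 2 * Real.cosh x ^ (-ν)) x := by
  refine (((Real.hasDerivAt_sinh x).const_mul (-ν)).mul
    (hasDerivAt_cosh_rpow (-ν - 1) x)).congr_deriv ?_
  have hc := Real.cosh_pos x
  have e1 : Real.cosh x ^ (-ν - 1) = Real.cosh x ^ (-ν) / Real.cosh x := by
    rw [Real.rpow_sub hc, Real.rpow_one]
  have e2 : Real.cosh x ^ (-ν - 1 - 1) = Real.cosh x ^ (-ν) / Real.cosh x ^ 2 := by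
    rw [Real.rpow_sub hc, Real.rpow_one, e1, pow_two, div_div]
  rw [e1, e2]
  have hs := Real.sinh_sq x
  field_simp
  rw [hs]
  ring

theorem abs_sinh_le_cosh (x : ℝ) : |Real.sinh x| ≤ Real.cosh x :=
  abs_le_of_sq_le_sq (by rw [Real.sinh_sq]; linarith) (Real.cosh_pos x).le

theorem integrable_inv_cosh_sq : Integrable fun x => 1 / Real.cosh x ^ 2 := by
  have h := (memLp_cosh_rpow one_pos).integrable_sq
  refine h.congr (ae_of_all _ fun x => ?_)
  simp only [Real.rpow_neg (Real.cosh_pos x).le, Real.rpow_one, inv_pow, one_div]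

theorem integral_inv_cosh_sq : ∫ x, 1 / Real.cosh x ^ 2 = 2 := by
  have hd : ∀ x, HasDerivAt Real.tanh (1 / Real.cosh x ^ 2) x := fun x => by
    have := (Real.hasDerivAt_sinh x).div (Real.hasDerivAt_cosh x) (Real.cosh_pos x).ne'
    have e : Real.tanh = fun x => Real.sinh x / Real.cosh x := funext Real.tanh_eq_sinh_div_cosh
    rw [e]
    refine this.congr_deriv ?_
    congr 1
    nlinarith [Real.cosh_sq x]
  have ht : Tendsto Real.tanh atTop (𝓝 1) := by
    have h1 : Tendsto (fun x : ℝ => Real.exp (-2 * x)) atTop (𝓝 0) :=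
      Real.tendsto_exp_atBot.comp (tendsto_id.const_mul_atTop_of_neg (by norm_num))
    have h2 : Tendsto (fun x : ℝ => (1 - Real.exp (-2 * x)) / (1 + Real.exp (-2 * x))) atTop
        (𝓝 ((1 - 0) / (1 + 0))) := (h1.const_sub 1).div (h1.const_add 1) (by norm_num)
    rw [sub_zero, add_zero, div_one] at h2
    refine h2.congr fun x => ?_
    rw [Real.tanh_eq_sinh_div_cosh, Real.sinh_eq, Real.cosh_eq]
    have : Real.exp (-x) = Real.exp x * Real.exp (-2 * x) := by rw [← Real.exp_add]; ring_nf
    rw [this]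
    have := Real.exp_pos x
    have := Real.exp_pos (-2 * x)
    field_simp
  have hb : Tendsto Real.tanh atBot (𝓝 (-1)) := by
    refine (ht.comp tendsto_neg_atBot_atTop).neg.congr fun x => ?_
    simp [Real.tanh_neg]
  rw [integral_of_hasDerivAt_of_tendsto hd integrable_inv_cosh_sq hb ht]
  norm_num

/-- With f = cosh^{-ν} and g = f', one has g' = ν²f + Vf. Integrating the derivative of φ̄g over the
line turns this equation into the weak form tested against φ in H¹. -/
theorem mem_opEigenspace_cosh {ν : ℝ} (hν : 0 < ν) {U : L2R}
    (hU : (fun x => ((Real.cosh x ^ (-ν) : ℝ) : ℂ)) =ᵐ[volume] U) :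
    U ∈ opEigenspace (schrodingerOp fun x => -(ν * (ν + 1)) / Real.cosh x ^ 2) (-ν ^ 2) := by
  set V : ℝ → ℝ := fun x => -(ν * (ν + 1)) / Real.cosh x ^ 2 with hV
  set f : ℝ → ℝ := fun x => Real.cosh x ^ (-ν) with hf
  set g : ℝ → ℝ := fun x => -ν * Real.sinh x * Real.cosh x ^ (-ν - 1) with hg
  have hcV : Continuous V :=
    continuous_const.div (Real.continuous_cosh.pow 2) fun x => (pow_pos (Real.cosh_pos x) 2).ne'
  have hcf : Continuous f := continuous_cosh_rpow _
  have hcg : Continuous g :=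
    (continuous_const.mul Real.continuous_sinh).mul (continuous_cosh_rpow _)
  have mf : MemLp f 2 volume := memLp_cosh_rpow hν
  have bV : ∀ x, ‖V x‖ ≤ ν * (ν + 1) := fun x => by
    have : 1 ≤ Real.cosh x ^ 2 := one_le_pow₀ (Real.one_le_cosh x)
    rw [hV, Real.norm_eq_abs, abs_div, abs_neg, abs_of_pos (by positivity : 0 < ν * (ν + 1)),
      abs_of_pos (by linarith)]
    exact div_le_self (by positivity) this
  have mg : MemLp g 2 volume := by
    refine (mf.const_mul ν).mono hcg.aestronglyMeasurable (ae_of_all _ fun x => ?_)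
    have hc := Real.cosh_pos x
    have e : g x = ν * f x * (-Real.sinh x / Real.cosh x) := by
      simp only [hg, hf, Real.rpow_sub hc, Real.rpow_one]
      ring
    rw [e, norm_mul]
    refine mul_le_of_le_one_right (norm_nonneg _) ?_
    rw [Real.norm_eq_abs, abs_div, abs_neg, abs_of_pos hc]
    exact div_le_one_of_le₀ (abs_sinh_le_cosh x) hc.le
  have mVf : MemLp (fun x => V x * f x) 2 volume := by
    refine (mf.const_mul (ν * (ν + 1))).mono (hcV.mul hcf).aestronglyMeasurable
      (ae_of_all _ fun x => ?_)
    rw [norm_mul, norm_mul, Real.norm_of_nonneg (by positivity : 0 ≤ ν * (ν + 1))]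
    exact mul_le_mul_of_nonneg_right (bV x) (norm_nonneg _)
  have mg' : MemLp (fun x => (g x : ℂ)) 2 volume := mg.ofReal
  have mVf' : MemLp (fun x => ((V x * f x : ℝ) : ℂ)) 2 volume := mVf.ofReal
  have pf : IsPrimitive (fun x => (f x : ℂ)) (fun x => (g x : ℂ)) :=
    (IsPrimitive.of_hasDerivAt (hasDerivAt_cosh_rpow (-ν)) hcg).ofReal
  have pg : IsPrimitive (fun x => (g x : ℂ)) (fun x => ((ν ^ 2 * f x + V x * f x : ℝ) : ℂ)) :=
    (IsPrimitive.of_hasDerivAt (hasDerivAt_sinh_mul_cosh_rpow ν)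
      ((continuous_const.mul hcf).add (hcV.mul hcf))).ofReal
  rw [mem_opEigenspace_schrodingerOp]
  refine ⟨mg'.toLp _, (pf.congr_ae mg'.coeFn_toLp.symm).hasWeakDeriv hU, fun φ φ' hφ => ?_⟩
  obtain ⟨Φ, hΦ, hp⟩ := hφ.exists_isPrimitive
  have i1 : Integrable fun x => starRingEnd ℂ (φ' x) * (g x : ℂ) := by
    refine (L2.integrable_inner (𝕜 := ℂ) φ' (mg'.toLp _)).congr ?_
    filter_upwards [mg'.coeFn_toLp] with x hx
    rw [hx, RCLike.inner_apply, mul_comm]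
  have i2 : Integrable fun x => starRingEnd ℂ (φ x) * (f x : ℂ) := by
    refine (L2.integrable_inner (𝕜 := ℂ) φ U).congr ?_
    filter_upwards [hU] with x hx
    rw [← hx, RCLike.inner_apply, mul_comm]
  have i3 : Integrable fun x => starRingEnd ℂ (φ x) * ((V x * f x : ℝ) : ℂ) := by
    refine (L2.integrable_inner (𝕜 := ℂ) φ (mVf'.toLp _)).congr ?_
    filter_upwards [mVf'.coeFn_toLp] with x hx
    rw [hx, RCLike.inner_apply, mul_comm]
  have i4 : Integrable fun x => starRingEnd ℂ (φ x) * (g x : ℂ) := by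
    refine (L2.integrable_inner (𝕜 := ℂ) φ (mg'.toLp _)).congr ?_
    filter_upwards [mg'.coeFn_toLp] with x hx
    rw [hx, RCLike.inner_apply, mul_comm]
  have epot : potentialDensity V φ U
      =ᵐ[volume] fun x => starRingEnd ℂ (φ x) * ((V x * f x : ℝ) : ℂ) := by
    filter_upwards [hU] with x hx
    simp only [potentialDensity, ← hx]
    push_cast
    ring
  have e1 : inner ℂ φ' (mg'.toLp _) = ∫ x, starRingEnd ℂ (φ' x) * (g x : ℂ) := by
    rw [L2.inner_def]
    refine integral_congr_ae ?_
    filter_upwards [mg'.coeFn_toLp] with x hx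
    rw [hx, RCLike.inner_apply, mul_comm]
  have e2 : inner ℂ φ U = ∫ x, starRingEnd ℂ (φ x) * (f x : ℂ) := by
    rw [L2.inner_def]
    refine integral_congr_ae ?_
    filter_upwards [hU] with x hx
    rw [← hx, RCLike.inner_apply, mul_comm]
  refine ⟨i3.congr epot.symm, ?_⟩
  have hparts := hp.conj.mul pg
  have es : (fun x => starRingEnd ℂ (φ' x) * (g x : ℂ)
        + starRingEnd ℂ (Φ x) * ((ν ^ 2 * f x + V x * f x : ℝ) : ℂ))
      =ᵐ[volume] fun x => starRingEnd ℂ (φ' x) * (g x : ℂ)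
        + ((ν : ℂ) ^ 2 * (starRingEnd ℂ (φ x) * (f x : ℂ))
          + starRingEnd ℂ (φ x) * ((V x * f x : ℝ) : ℂ)) := by
    filter_upwards [hΦ] with x hx
    rw [hx]
    push_cast
    ring
  have i5 : Integrable fun x => (ν : ℂ) ^ 2 * (starRingEnd ℂ (φ x) * (f x : ℂ))
      + starRingEnd ℂ (φ x) * ((V x * f x : ℝ) : ℂ) := (i2.const_mul ((ν : ℂ) ^ 2)).add i3
  have h0 := hparts.integral_eq_zero ((i1.add i5).congr es.symm) (i4.congr (by
    filter_upwards [hΦ] with x hx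
    rw [hx]))
  rw [integral_congr_ae es, integral_add i1 i5, integral_add (i2.const_mul _) i3,
    integral_const_mul, ← e1, ← e2] at h0
  rw [integral_congr_ae epot, inner_smul_right, Complex.ofReal_neg, Complex.ofReal_pow]
  linear_combination h0

theorem le_negEigenvalueSum_cosh {ν : ℝ} (hν : 0 < ν) :
    ENNReal.ofReal ν ≤
      negEigenvalueSum (schrodingerOp fun x => -(ν * (ν + 1)) / Real.cosh x ^ 2) (1 / 2) := by
  have m : MemLp (fun x => ((Real.cosh x ^ (-ν) : ℝ) : ℂ)) 2 volume := (memLp_cosh_rpow hν).ofReal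
  have hmem := mem_opEigenspace_cosh hν m.coeFn_toLp.symm
  have hne : (m.toLp _ : L2R) ≠ 0 := by
    intro h0
    have h1 : (fun x => ((Real.cosh x ^ (-ν) : ℝ) : ℂ)) =ᵐ[volume] 0 :=
      (MemLp.toLp_eq_toLp_iff m MemLp.zero).1 (by rw [h0]; rfl)
    obtain ⟨x, hx⟩ := h1.exists
    exact (Real.rpow_pos_of_pos (Real.cosh_pos x) (-ν)).ne' (Complex.ofReal_eq_zero.1 hx)
  set H := schrodingerOp fun x => -(ν * (ν + 1)) / Real.cosh x ^ 2
  have hmult : 1 ≤ eigenMultiplicity H (-ν ^ 2) := by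
    have : Nontrivial (opEigenspace H (-ν ^ 2)) :=
      ⟨⟨⟨_, hmem⟩, 0, fun h => hne (congrArg Subtype.val h)⟩⟩
    rw [eigenMultiplicity, Cardinal.one_le_toENat, Cardinal.one_le_iff_pos]
    exact rank_pos
  have hlt : -ν ^ 2 < 0 := neg_lt_zero.2 (pow_pos hν 2)
  refine le_trans ?_ (ENNReal.le_tsum (⟨-ν ^ 2, hlt⟩ : Set.Iio (0 : ℝ)))
  have e : |-ν ^ 2| ^ (1 / 2 : ℝ) = ν := by
    rw [abs_neg, abs_of_pos (pow_pos hν 2), ← Real.sqrt_eq_rpow, Real.sqrt_sq hν.le]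
  simp only [e]
  have h1 : (1 : ENNReal) ≤ ((eigenMultiplicity H (-ν ^ 2) : ℕ∞) : ENNReal) := by
    exact_mod_cast hmult
  calc ENNReal.ofReal ν = 1 * ENNReal.ofReal ν := (one_mul _).symm
    _ ≤ _ := by gcongr

theorem half_le_of_forall_negEigenvalueSum_le {C : ℝ}
    (h : ∀ V : ℝ → ℝ, Integrable V →
      negEigenvalueSum (schrodingerOp V) (1 / 2) ≤ ENNReal.ofReal (C * ∫ x, (V x)⁻)) :
    1 / 2 ≤ C := by
  have key : ∀ ν : ℝ, 0 < ν → 1 ≤ 2 * C * (ν + 1) := by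
    intro ν hν
    have hVi : Integrable fun x => -(ν * (ν + 1)) / Real.cosh x ^ 2 := by
      refine (integrable_inv_cosh_sq.const_mul (-(ν * (ν + 1)))).congr (ae_of_all _ fun x => ?_)
      simp only
      ring
    have e : ∫ x, (-(ν * (ν + 1)) / Real.cosh x ^ 2)⁻ = 2 * (ν * (ν + 1)) := by
      have : ∀ x, (-(ν * (ν + 1)) / Real.cosh x ^ 2)⁻
          = ν * (ν + 1) * (1 / Real.cosh x ^ 2) := fun x => by
        have hc := Real.cosh_pos x
        rw [neg_div, negPart_neg, posPart_of_nonneg (by positivity)]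
        ring
      simp only [this]
      rw [integral_const_mul, integral_inv_cosh_sq]
      ring
    have h1 := (le_negEigenvalueSum_cosh hν).trans (h _ hVi)
    -- `C` is not known to be nonnegative; the truncation in `ENNReal.ofReal` is harmless because
    -- the alternative ν ≤ 0 is excluded.
    rw [e, ENNReal.ofReal_le_ofReal_iff'] at h1
    rcases h1 with h1 | h1
    · have h2 : ν * 1 ≤ ν * (2 * C * (ν + 1)) := by linarith
      exact le_of_mul_le_mul_left h2 hν
    · linarith
  have hlim : Tendsto (fun ν : ℝ => 2 * C * (ν + 1)) (𝓝[>] 0) (𝓝 (2 * C * (0 + 1))) :=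
    ((continuous_const.mul (continuous_id.add continuous_const)).tendsto 0).mono_left
      nhdsWithin_le_nhds
  have := ge_of_tendsto hlim (by filter_upwards [self_mem_nhdsWithin] with ν hν using key ν hν)
  linarith

/-! ### The semiclassical constant and the conclusion. -/

theorem two_mul_semiclassicalConst : 2 * semiclassicalConst (1 / 2) 1 = 1 / 2 := by
  have h1 : Real.Gamma (1 / 2 + 1) = 1 / 2 * √Real.pi := by
    rw [Real.Gamma_add_one (by norm_num), Real.Gamma_one_half_eq]
  have h2 : Real.Gamma (1 / 2 + 1 + ((1 : ℕ) : ℝ) / 2) = 1 := by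
    rw [show (1 / 2 + 1 + ((1 : ℕ) : ℝ) / 2 : ℝ) = 2 by norm_num, Real.Gamma_two]
  have h3 : (4 * Real.pi) ^ (-((1 : ℕ) : ℝ) / 2) = (2 * √Real.pi)⁻¹ := by
    rw [show (-((1 : ℕ) : ℝ) / 2 : ℝ) = -(1 / 2) by norm_num, Real.rpow_neg (by positivity),
      ← Real.sqrt_eq_rpow, Real.sqrt_mul (by norm_num), show (4 : ℝ) = 2 ^ 2 by norm_num,
      Real.sqrt_sq (by norm_num)]
  rw [semiclassicalConst, h1, h2, h3]
  have : 0 < √Real.pi := Real.sqrt_pos.2 Real.pi_pos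
  field_simp

theorem mainTheorem7 :
    (∀ V : ℝ → ℝ, Integrable V →
      negEigenvalueSum (schrodingerOp V) (1 / 2) ≤ ENNReal.ofReal (1 / 2 * ∫ x, (V x)⁻)) ∧
    (∀ C : ℝ,
      (∀ V : ℝ → ℝ, Integrable V →
        negEigenvalueSum (schrodingerOp V) (1 / 2) ≤ ENNReal.ofReal (C * ∫ x, (V x)⁻)) →
      1 / 2 ≤ C) ∧
    2 * semiclassicalConst (1 / 2) 1 = 1 / 2 :=
  ⟨fun _ hV => negEigenvalueSum_le hV, fun _ h => half_le_of_forall_negEigenvalueSum_le h,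
    two_mul_semiclassicalConst⟩
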